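/- For integers $L\ge 1$ and $d,m$, let $f=f_{L,m}$ be the fully connected ReLU network with $L$ hidden layers of width $m$, input $\mathbf{x}\in\mathbb{R}^d$ and scalar output: with $\sigma(z)=\max\{0,z\}$ applied entrywise, $$\alpha^{(0)}(\mathbf{x})=\mathbf{x},\qquad \alpha^{(l)}(\mathbf{x})=\frac{\sqrt2}{\sqrt m}\,\sigma\big(W^{(l)}\alpha^{(l-1)}(\mathbf{x})\big)\ (1\le l\le L),\qquad f(\mathbf{x})=W^{(L+1)}\alpha^{(L)}(\mathbf{x}),$$ where all entries of $W^{(1)}\in\mathbb{R}^{m\times d}$, $W^{(2)},\dots,W^{(L)}\in\mathbb{R}^{m\times m}$, $W^{(L+1)}\in\mathbb{R}^{1\times m}$ are initialized as i.i.d. $\mathcal N(0,1)$ random variables. Given a dataset with two inputs $\mathbf{x}_1,\mathbf{x}_2\in\mathbb{R}^d$, the neural tangent kernel (NTK) matrix at initialization has entries $\langle\nabla f(\mathbf{x}_i),\nabla f(\mathbf{x}_j)\rangle$, $i,j\in\{1,2\}$, where $\nabla$ is the gradient with respect to all the parameters; the NTK matrix $K_L$ of the infinitely wide network of depth $L$ is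 its entrywise limit in probability as $m\to\infty$. Let $G=(\langle\mathbf{x}_i,\mathbf{x}_j\rangle)_{i,j}$ be the Gram matrix, and let the condition number of a positive definite matrix be the ratio of its largest to its smallest eigenvalue. There is an absolute constant $c>0$ such that for every $d$ and all nonzero $\mathbf{x}_1,\mathbf{x}_2\in\mathbb{R}^d$ with angle $\theta_{in}>0$ between them, the following hold. 1. For every $L\ge1$ with $\theta_{in}\le c/L$, the limit $K_L$ exists, $K_L$ and $G$ are positive definite, and their condition numbers $\kappa$ of $K_L$ and $\kappa_0$ of $G$ satisfy $\kappa<\kappa_0$. 2. For all $L_1>L_2\ge1$ with $\theta_{in}\le c/L_1$, the limits $K_{L_1}$ and $K_{L_2}$ exist and are positive definite, and the condition number of $K_{L_1}$ is strictly smaller than that of $K_{L_2}$. -/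

import Mathlib

noncomputable section

namespace DeepReLU

open MeasureTheory ProbabilityTheory Filter Topology

/-- The ReLU activation function `z ↦ max {0, z}`. -/
def relu (z : ℝ) : ℝ := max 0 z

/-- Layer widths: the input layer has `d` neurons, every hidden layer has `m` neurons. -/
def width (d m : ℕ) : ℕ → ℕ
  | 0 => d
  | _ + 1 => m

/-- Index set of all the parameters of a fully connected network with input dimension `d`,
hidden width `m` and `L` hidden layers: the entries of the `L` hidden weight matrices
(the `l`-th one, counted from `0`, has size `width (l + 1) × width l`) and the entries of the
output row vector. -/
abbrev ParamIndex (d m L : ℕ) : Type :=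
  (Σ l : Fin L, Fin (width d m (l + 1)) × Fin (width d m l)) ⊕ Fin (width d m L)

/-- The parameter space. -/
abbrev Params (d m L : ℕ) : Type := EuclideanSpace ℝ (ParamIndex d m L)

/-- The weight matrix from layer `l` to layer `l + 1`, for `l + 1 ≤ L`. -/
def hiddenWeight {d m L : ℕ} (w : Params d m L) (l : Fin L) :
    Matrix (Fin (width d m (l + 1))) (Fin (width d m l)) ℝ :=
  Matrix.of fun i j => w (Sum.inl ⟨l, (i, j)⟩)

/-- The output weights, a single row because the network has one output. -/
def outputWeight {d m L : ℕ} (w : Params d m L) : Fin (width d m L) → ℝ :=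
  fun j => w (Sum.inr j)

/-- The `l`-embedding of the input `x`: `α⁰ = x` and
`αˡ⁺¹ = (√2 / √m) σ(W αˡ)`, with the ReLU `σ` applied entrywise. -/
def embedding {d m L : ℕ} (w : Params d m L) (x : EuclideanSpace ℝ (Fin d)) :
    (l : ℕ) → l ≤ L → (Fin (width d m l) → ℝ)
  | 0, _ => fun i => x i
  | l + 1, h => fun i =>
      Real.sqrt 2 / Real.sqrt m *
        relu ((hiddenWeight w ⟨l, h⟩).mulVec (embedding w x l (Nat.le_of_succ_le h)) i)

/-- The scalar output of the ReLU network with `L` hidden layers of width `m`. -/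
def network {d m L : ℕ} (w : Params d m L) (x : EuclideanSpace ℝ (Fin d)) : ℝ :=
  dotProduct (outputWeight w) (embedding w x L le_rfl)

/-- The model gradient: the gradient of the output with respect to all the parameters. -/
def modelGradient {d m L : ℕ} (w : Params d m L) (x : EuclideanSpace ℝ (Fin d)) :
    Params d m L :=
  gradient (fun v : Params d m L => network v x) w

/-- The neural tangent kernel matrix of a dataset with inputs `x` at the parameters `w`. -/
def ntkMatrix {d m L n : ℕ} (w : Params d m L) (x : Fin n → EuclideanSpace ℝ (Fin d)) :
    Matrix (Fin n) (Fin n) ℝ :=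
  Matrix.of fun i j => inner ℝ (modelGradient w (x i)) (modelGradient w (x j))

/-- The law of the parameters at initialization: all entries i.i.d. standard normal. -/
def initLaw (d m L : ℕ) : Measure (Params d m L) :=
  (Measure.pi fun _ : ParamIndex d m L => gaussianReal 0 1).map (WithLp.toLp 2)

/-- `K` is the NTK matrix at initialization of the infinitely wide ReLU network with `L` hidden
layers: as all hidden widths `m` tend to infinity together, every entry of the NTK matrix at
random initialization converges in probability to the corresponding entry of `K`. -/
def IsInfiniteWidthNTK {d n : ℕ} (L : ℕ) (x : Fin n → EuclideanSpace ℝ (Fin d))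
    (K : Matrix (Fin n) (Fin n) ℝ) : Prop :=
  ∀ i j : Fin n, ∀ ε : ℝ, 0 < ε →
    Tendsto (fun m : ℕ => initLaw d m L {w | ε ≤ |ntkMatrix w x i j - K i j|}) atTop (𝓝 0)

/-- The feature matrix, whose rows are the inputs. -/
def featureMatrix {d n : ℕ} (x : Fin n → EuclideanSpace ℝ (Fin d)) :
    Matrix (Fin n) (Fin d) ℝ :=
  Matrix.of fun i k => x i k

/-- The Gram matrix of the inputs. -/
def gramMatrix {d n : ℕ} (x : Fin n → EuclideanSpace ℝ (Fin d)) : Matrix (Fin n) (Fin n) ℝ :=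
  featureMatrix x * (featureMatrix x).transpose

/-- The condition number of a positive definite matrix: the ratio of its largest to its smallest
eigenvalue (the spectrum of a matrix is its finite set of eigenvalues). -/
def conditionNumber {n : ℕ} (A : Matrix (Fin n) (Fin n) ℝ) : ℝ :=
  sSup (spectrum ℝ A) / sInf (spectrum ℝ A)

end DeepReLU

end

/-! Both claims reduce to the strict monotonicity of a scalar sequence. In the infinite-width limit
the NTK entry of `x i`, `x j` is `‖x i‖ * ‖x j‖ * ntkSeq r L`, with `r` the cosine of the input
angle. Since `ntkSeq 1 L = L + 1`, the matrix is `L + 1` times a Gram matrix of vectors of the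
original norms, whose cosine is `ρ_L = ntkSeq (cos θ) L / (L + 1)`. The data Gram matrix is the case
`L = 0`. For fixed norms the condition number ignores the scale and increases strictly with the
cosine (`conditionNumber_pairMatrix_lt`), so it remains to see that `ρ_L` decreases strictly in `L`
(`ntkSeq_div_strictAnti`).

Existence of the limit (`isInfiniteWidthNTK_limit`): given the earlier layers, inner products of
embeddings are averages over i.i.d. Gaussian rows, so Chebyshev's inequality puts them near
arc-cosine kernel values. The Gram matrix `A` of the embedding gradients obeys a recursion of its
own, in which quadratic forms `wᵀ A w` of fresh Gaussian weights appear. Their variance is at most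
twice the squared Frobenius norm of `A`, so they may be replaced by the trace as long as that norm
tends to zero. This smallness is the extra invariant carried from layer to layer (`LayerNear`,
`layerNear_step`, `eventually_layerNear`). The output layer is one more such quadratic form.

Monotonicity (`ntkSeq_div_lt`): with `φ_l` the limiting angle at layer `l` and `k_l` the normalized
kernel, `k_{l+1} = cos φ_{l+1} + (1 - φ_l / π) * k_l`. As `cos φ_{l+1} ≤ 1`, the decrease follows
from `l + 1 < k_l * (1 + (l + 1) * φ_l / π)`. For `l * θ` bounded by a small constant the angle
contracts slowly, so `φ_l ≥ 3θ/4`, while `k_l` loses at most the fraction `(l + 1) * θ / (2π)` of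
its maximum `l + 1`. Since `3/4 > 1/2`, the gain wins to first order. -/

noncomputable section

namespace DeepReLU

open MeasureTheory ProbabilityTheory Filter Topology
open scoped NNReal ENNReal

/-! ### Functions with finite moments of all orders -/

/-- `f` has finite absolute moments of every order. -/
def AllMoments {Ω : Type*} [MeasurableSpace Ω] (f : Ω → ℝ) (μ : Measure Ω) : Prop :=
  ∀ p : ℝ≥0∞, p ≠ ∞ → MemLp f p μ

namespace AllMoments

variable {Ω : Type*} [MeasurableSpace Ω] {μ : Measure Ω} {f g : Ω → ℝ}

lemma add (hf : AllMoments f μ) (hg : AllMoments g μ) : AllMoments (fun x => f x + g x) μ :=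
  fun p hp => (hf p hp).add (hg p hp)

lemma sub (hf : AllMoments f μ) (hg : AllMoments g μ) : AllMoments (fun x => f x - g x) μ :=
  fun p hp => (hf p hp).sub (hg p hp)

/-- Hölder with both exponents `2 * p`. Closure under products is the reason for asking for all
moments at once: a single `L^p` space is not an algebra. -/
lemma mul (hf : AllMoments f μ) (hg : AllMoments g μ) : AllMoments (fun x => f x * g x) μ := by
  intro p hp
  have h2 : (2 * p : ℝ≥0∞) ≠ ∞ := ENNReal.mul_ne_top (by simp) hp
  have : ENNReal.HolderTriple (2 * p) (2 * p) p := ⟨by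
    rw [ENNReal.mul_inv (by simp) (by simp), ← add_mul, ENNReal.inv_two_add_inv_two, one_mul]⟩
  exact (hg _ h2).mul' (hf _ h2)

lemma const [IsFiniteMeasure μ] (c : ℝ) : AllMoments (fun _ : Ω => c) μ :=
  fun _ _ => memLp_const c

lemma pow [IsFiniteMeasure μ] (hf : AllMoments f μ) (n : ℕ) : AllMoments (fun x => f x ^ n) μ := by
  induction n with
  | zero => simpa using const (μ := μ) 1
  | succ n ih => simpa only [pow_succ] using ih.mul hf

lemma sum {ι : Type*} {s : Finset ι} {F : ι → Ω → ℝ} (h : ∀ i ∈ s, AllMoments (F i) μ) :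
    AllMoments (fun x => ∑ i ∈ s, F i x) μ :=
  fun p hp => memLp_finsetSum s fun i hi => h i hi p hp

lemma mono (hf : AllMoments f μ) (hg : AEStronglyMeasurable g μ) (h : ∀ x, |g x| ≤ |f x|) :
    AllMoments g μ :=
  fun p hp => (hf p hp).mono hg (ae_of_all _ h)

lemma integrable (hf : AllMoments f μ) : Integrable f μ :=
  memLp_one_iff_integrable.1 (hf 1 (by simp))

lemma memLp_two (hf : AllMoments f μ) : MemLp f 2 μ := hf 2 (by simp)

lemma comp {Ω' : Type*} [MeasurableSpace Ω'] {ν : Measure Ω'} {T : Ω' → Ω}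
    (hf : AllMoments f μ) (hT : MeasurePreserving T ν μ) : AllMoments (fun x => f (T x)) ν :=
  fun p hp => (hf p hp).comp_measurePreserving hT

end AllMoments

/-! ### Standard Gaussian vectors -/

/-- The law of a vector with i.i.d. standard normal entries. -/
def gaussVec (ι : Type*) [Fintype ι] : Measure (ι → ℝ) :=
  Measure.pi fun _ => gaussianReal 0 1

instance (ι : Type*) [Fintype ι] : IsProbabilityMeasure (gaussVec ι) := by
  unfold gaussVec; infer_instance

section

variable {ι κ : Type*} [Fintype ι] [Fintype κ]

lemma allMoments_coord (i : ι) : AllMoments (fun w : ι → ℝ => w i) (gaussVec ι) := by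
  have h : AllMoments (fun x : ℝ => x) (gaussianReal 0 1) :=
    fun p hp => memLp_id_gaussianReal' p hp
  exact h.comp (measurePreserving_eval (fun _ : ι => gaussianReal 0 1) i)

lemma allMoments_dot (u : ι → ℝ) : AllMoments (fun w => dotProduct w u) (gaussVec ι) :=
  AllMoments.sum fun i _ => (allMoments_coord i).mul (AllMoments.const _)

@[fun_prop]
lemma measurable_dot (u : ι → ℝ) : Measurable fun w : ι → ℝ => dotProduct w u := by
  unfold dotProduct; fun_prop

lemma integral_cexp_dot (u : ι → ℝ) :
    ∫ w, Complex.exp ((dotProduct w u : ℝ) * Complex.I) ∂gaussVec ι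
      = Complex.exp (-(dotProduct u u : ℝ) / 2) := by
  unfold gaussVec dotProduct
  simp_rw [Complex.ofReal_sum, Finset.sum_mul, Complex.exp_sum]
  rw [integral_fintype_prod_eq_prod (f := fun i (x : ℝ) => Complex.exp (((x * u i : ℝ) : ℂ) * Complex.I))]
  have h : ∀ i, ∫ x : ℝ, Complex.exp (((x * u i : ℝ) : ℂ) * Complex.I) ∂gaussianReal 0 1
      = Complex.exp (-((u i * u i : ℝ) : ℂ) / 2) := by
    intro i
    have := charFun_gaussianReal (μ := 0) (v := 1) (u i)
    rw [charFun_apply_real] at this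
    convert this using 2
    · ext x; push_cast; ring_nf
    · push_cast; ring_nf
  simp_rw [h]
  rw [← Complex.exp_sum]
  congr 1
  rw [← Finset.sum_neg_distrib, Finset.sum_div]

/-- A linear functional of the pair is again one linear functional of the Gaussian vector, so the
one-dimensional characteristic function suffices. -/
lemma charFunDual_map_dot_pair (a b : ι → ℝ) (T : StrongDual ℝ (ℝ × ℝ)) :
    charFunDual ((gaussVec ι).map (fun w => (dotProduct w a, dotProduct w b))) T
      = Complex.exp (-((T (1, 0) ^ 2 * dotProduct a a + 2 * T (1, 0) * T (0, 1) * dotProduct a b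
          + T (0, 1) ^ 2 * dotProduct b b : ℝ) : ℂ) / 2) := by
  rw [charFunDual_apply, integral_map (by fun_prop) (by fun_prop)]
  have : ∀ w : ι → ℝ, T (dotProduct w a, dotProduct w b)
      = dotProduct w (T (1, 0) • a + T (0, 1) • b) := by
    intro w
    have : ((dotProduct w a, dotProduct w b) : ℝ × ℝ)
        = dotProduct w a • ((1 : ℝ), (0 : ℝ)) + dotProduct w b • ((0 : ℝ), (1 : ℝ)) := by
      simp
    rw [this, map_add, map_smul, map_smul, dotProduct_add, dotProduct_smul, dotProduct_smul]
    simp [mul_comm]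
  simp_rw [this]
  rw [integral_cexp_dot]
  congr 4
  simp only [dotProduct_add, add_dotProduct, smul_dotProduct, dotProduct_smul, smul_eq_mul,
    dotProduct_comm b a]
  ring

/-- The joint law of two linear functionals of a standard Gaussian vector depends only on the
Gram matrix of the two coefficient vectors. -/
lemma map_dot_pair_eq {u v : ι → ℝ} {u' v' : κ → ℝ} (h1 : dotProduct u u = dotProduct u' u')
    (h2 : dotProduct u v = dotProduct u' v') (h3 : dotProduct v v = dotProduct v' v') :
    (gaussVec ι).map (fun w => (dotProduct w u, dotProduct w v))
      = (gaussVec κ).map (fun w => (dotProduct w u', dotProduct w v')) := by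
  have : IsProbabilityMeasure ((gaussVec ι).map (fun w => (dotProduct w u, dotProduct w v))) :=
    Measure.isProbabilityMeasure_map (by fun_prop)
  have : IsProbabilityMeasure ((gaussVec κ).map (fun w => (dotProduct w u', dotProduct w v'))) :=
    Measure.isProbabilityMeasure_map (by fun_prop)
  refine Measure.ext_of_charFunDual ?_
  ext T
  rw [charFunDual_map_dot_pair, charFunDual_map_dot_pair, h1, h2, h3]

lemma integral_pow_four_gaussianReal : ∫ x, x ^ 4 ∂gaussianReal 0 1 = 3 := by
  -- The fourth moment is the fourth derivative at `0` of the moment generating function `exp (t ^ 2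
  -- / 2)`, differentiated by hand below.
  have h := iteratedDeriv_mgf_zero (X := fun x : ℝ => x) (μ := gaussianReal 0 1) (by simp) 4
  have h' : (∫ x, x ^ 4 ∂gaussianReal 0 1) = iteratedDeriv 4 (mgf (fun x : ℝ => x) (gaussianReal 0 1)) 0 := by
    rw [h]; rfl
  rw [h', mgf_fun_id_gaussianReal]
  have hE : ∀ t : ℝ, HasDerivAt (fun t : ℝ => Real.exp (t ^ 2 / 2)) (t * Real.exp (t ^ 2 / 2)) t := by
    intro t
    have := (((hasDerivAt_id t).pow 2).div_const 2).exp
    simp only [id, Pi.pow_apply] at this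
    convert! this using 1
    simp; ring
  have e0 : (fun t : ℝ => Real.exp (0 * t + ((1 : ℝ≥0) : ℝ) * t ^ 2 / 2))
      = fun t => Real.exp (t ^ 2 / 2) := by ext t; simp
  have d1 : deriv (fun t : ℝ => Real.exp (t ^ 2 / 2)) = fun t => t * Real.exp (t ^ 2 / 2) :=
    funext fun t => (hE t).deriv
  have d2 : deriv (fun t : ℝ => t * Real.exp (t ^ 2 / 2))
      = fun t => (1 + t ^ 2) * Real.exp (t ^ 2 / 2) := by
    ext t
    rw [((hasDerivAt_id' t).fun_mul (hE t)).deriv]; ring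
  have d3 : deriv (fun t : ℝ => (1 + t ^ 2) * Real.exp (t ^ 2 / 2))
      = fun t => (3 * t + t ^ 3) * Real.exp (t ^ 2 / 2) := by
    ext t
    rw [((((hasDerivAt_id' t).fun_pow 2).const_add 1).fun_mul (hE t)).deriv]
    simp; ring
  have d4 : deriv (fun t : ℝ => (3 * t + t ^ 3) * Real.exp (t ^ 2 / 2))
      = fun t => (3 + 6 * t ^ 2 + t ^ 4) * Real.exp (t ^ 2 / 2) := by
    ext t
    rw [((((hasDerivAt_id' t).const_mul 3).fun_add ((hasDerivAt_id' t).fun_pow 3)).fun_mul (hE t)).deriv]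
    simp; ring
  rw [e0, iteratedDeriv_succ, iteratedDeriv_succ, iteratedDeriv_succ, iteratedDeriv_one,
    d1, d2, d3, d4]
  simp

/-- A linear functional of a standard Gaussian vector has the law of one normal variable scaled by
the norm; the comparison vector is indexed by `Unit`. -/
lemma integral_comp_dot (u : ι → ℝ) (F : ℝ → ℝ) (hF : Measurable F) :
    ∫ w, F (dotProduct w u) ∂gaussVec ι
      = ∫ x, F (Real.sqrt (dotProduct u u) * x) ∂gaussianReal 0 1 := by
  have hu : 0 ≤ dotProduct u u := Finset.sum_nonneg fun i _ => mul_self_nonneg (u i)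
  have hl := map_dot_pair_eq (u := u) (v := u)
    (u' := fun _ : Unit => Real.sqrt (dotProduct u u))
    (v' := fun _ : Unit => Real.sqrt (dotProduct u u))
    (by simp [dotProduct]; exact (Real.mul_self_sqrt hu).symm)
    (by simp [dotProduct]; exact (Real.mul_self_sqrt hu).symm)
    (by simp [dotProduct]; exact (Real.mul_self_sqrt hu).symm)
  have hF' : Measurable fun p : ℝ × ℝ => F p.1 := hF.comp measurable_fst
  have hF'' : Measurable fun x : ℝ => F (Real.sqrt (dotProduct u u) * x) :=
    hF.comp (measurable_const_mul _)
  have h1 := integral_map (μ := gaussVec ι) (φ := fun w => (dotProduct w u, dotProduct w u))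
    (by fun_prop) hF'.aestronglyMeasurable
  rw [hl, integral_map (by fun_prop) hF'.aestronglyMeasurable] at h1
  rw [← h1, ← (measurePreserving_eval (fun _ : Unit => gaussianReal 0 1) ()).map_eq,
    integral_map (measurable_pi_apply _).aemeasurable hF''.aestronglyMeasurable]
  simp [dotProduct, gaussVec, mul_comm]

lemma integral_dot_pow_four (u : ι → ℝ) :
    ∫ w, dotProduct w u ^ 4 ∂gaussVec ι = 3 * dotProduct u u ^ 2 := by
  have hu : 0 ≤ dotProduct u u := Finset.sum_nonneg fun i _ => mul_self_nonneg (u i)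
  rw [integral_comp_dot u (fun x => x ^ 4) (by fun_prop)]
  simp_rw [mul_pow]
  rw [integral_const_mul, integral_pow_four_gaussianReal]
  have : Real.sqrt (dotProduct u u) ^ 4 = dotProduct u u ^ 2 := by
    rw [show (4 : ℕ) = 2 * 2 from rfl, pow_mul, Real.sq_sqrt hu]
  rw [this]; ring

lemma integral_sq_gaussianReal : ∫ x, x ^ 2 ∂gaussianReal 0 1 = 1 := by
  have h := variance_eq_integral (μ := gaussianReal 0 1) (X := fun x : ℝ => x) (by fun_prop)
  simpa using h.symm

lemma integral_dot_sq (u : ι → ℝ) :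
    ∫ w, dotProduct w u ^ 2 ∂gaussVec ι = dotProduct u u := by
  have hu : 0 ≤ dotProduct u u := Finset.sum_nonneg fun i _ => mul_self_nonneg (u i)
  rw [integral_comp_dot u (fun x => x ^ 2) (by fun_prop)]
  simp_rw [mul_pow]
  rw [integral_const_mul, integral_sq_gaussianReal, Real.sq_sqrt hu, mul_one]

lemma integral_dot_mul_dot (u v : ι → ℝ) :
    ∫ w, dotProduct w u * dotProduct w v ∂gaussVec ι = dotProduct u v := by
  have e : ∀ w : ι → ℝ, dotProduct w u * dotProduct w v
      = (1 / 4) * (dotProduct w (u + v) ^ 2 - dotProduct w (u - v) ^ 2) := by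
    intro w; rw [dotProduct_add, dotProduct_sub]; ring
  simp_rw [e]
  rw [integral_const_mul, integral_sub ((allMoments_dot _).pow 2).integrable
    ((allMoments_dot _).pow 2).integrable, integral_dot_sq, integral_dot_sq]
  simp only [dotProduct_add, add_dotProduct, dotProduct_sub, sub_dotProduct, dotProduct_comm v u]
  ring

/-- Isserlis' formula for the fourth mixed moments of a standard Gaussian vector. -/
lemma integral_dot_four (a b c e : ι → ℝ) :
    ∫ w, dotProduct w a * dotProduct w b * (dotProduct w c * dotProduct w e) ∂gaussVec ι
      = dotProduct a b * dotProduct c e + dotProduct a c * dotProduct b e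
        + dotProduct a e * dotProduct b c := by
  have hi : ∀ u : ι → ℝ, Integrable (fun w => dotProduct w u ^ 4) (gaussVec ι) :=
    fun u => ((allMoments_dot _).pow 4).integrable
  -- Polarization: of the sixteen sign patterns only the eight with leading sign plus are needed,
  -- and each contributes `4! = 24` times the mixed product, whence `192 = 8 * 24`. The formula then
  -- follows from the fourth moment of a single linear functional.
  have hexp : ∀ w : ι → ℝ, dotProduct w a * dotProduct w b * (dotProduct w c * dotProduct w e)
      = (1 / 192) * ((((dotProduct w (a + b + c + e) ^ 4 - dotProduct w (a + b + c - e) ^ 4)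
        + (dotProduct w (a + b - c - e) ^ 4 - dotProduct w (a + b - c + e) ^ 4))
        + (dotProduct w (a - b + c - e) ^ 4 - dotProduct w (a - b + c + e) ^ 4))
        + (dotProduct w (a - b - c + e) ^ 4 - dotProduct w (a - b - c - e) ^ 4)) := by
    intro w; simp only [dotProduct_add, dotProduct_sub]; ring
  simp_rw [hexp]
  rw [integral_const_mul, integral_add, integral_add, integral_add, integral_sub, integral_sub,
    integral_sub, integral_sub]
  any_goals (repeat' first | exact hi _ | apply Integrable.sub | apply Integrable.add)
  simp only [integral_dot_pow_four]
  simp only [dotProduct_add, add_dotProduct, dotProduct_sub, sub_dotProduct,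
    dotProduct_comm b a, dotProduct_comm c a, dotProduct_comm e a, dotProduct_comm c b,
    dotProduct_comm e b, dotProduct_comm e c]
  ring

end

/-! ### Gaussian quadratic forms -/

/-- The squared Frobenius norm. -/
def frobSq {ι κ : Type*} [Fintype ι] [Fintype κ] (A : Matrix ι κ ℝ) : ℝ := ∑ i, ∑ j, A i j ^ 2

lemma frobSq_nonneg {ι κ : Type*} [Fintype ι] [Fintype κ] (A : Matrix ι κ ℝ) : 0 ≤ frobSq A :=
  Finset.sum_nonneg fun _ _ => Finset.sum_nonneg fun _ _ => sq_nonneg _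

/-- The bilinear form of a matrix. -/
def bilin {ι κ : Type*} [Fintype ι] [Fintype κ] (A : Matrix ι κ ℝ) (v : ι → ℝ) (w : κ → ℝ) : ℝ :=
  ∑ i, ∑ j, A i j * (v i * w j)

section

variable {ι : Type*} [Fintype ι]

lemma integral_coord_mul [DecidableEq ι] (i j : ι) :
    ∫ w : ι → ℝ, w i * w j ∂gaussVec ι = if i = j then 1 else 0 := by
  have h := integral_dot_mul_dot (Pi.single i (1 : ℝ)) (Pi.single j (1 : ℝ))
  simpa [Pi.single_apply, eq_comm] using h

lemma integral_coord_four [DecidableEq ι] (i j k l : ι) :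
    ∫ w : ι → ℝ, w i * w j * (w k * w l) ∂gaussVec ι
      = (if i = j then 1 else 0) * (if k = l then 1 else 0)
        + (if i = k then 1 else 0) * (if j = l then 1 else 0)
        + (if i = l then 1 else 0) * (if j = k then 1 else 0) := by
  have h := integral_dot_four (Pi.single i (1 : ℝ)) (Pi.single j (1 : ℝ)) (Pi.single k (1 : ℝ))
    (Pi.single l (1 : ℝ))
  simp only [dotProduct_single, mul_one, Pi.single_apply] at h
  simp only [h, eq_comm (a := j) (b := i), eq_comm (a := l) (b := k), eq_comm (a := k) (b := i),
    eq_comm (a := l) (b := j), eq_comm (a := l) (b := i), eq_comm (a := k) (b := j)]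

lemma allMoments_bilin (A : Matrix ι ι ℝ) : AllMoments (fun w => bilin A w w) (gaussVec ι) :=
  AllMoments.sum fun i _ => AllMoments.sum fun j _ =>
    (AllMoments.const _).mul ((allMoments_coord i).mul (allMoments_coord j))

lemma integral_bilin (A : Matrix ι ι ℝ) : ∫ w, bilin A w w ∂gaussVec ι = A.trace := by
  classical
  unfold bilin
  have hi : ∀ i j, Integrable (fun w : ι → ℝ => A i j * (w i * w j)) (gaussVec ι) := fun i j =>
    (((AllMoments.const _).mul ((allMoments_coord i).mul (allMoments_coord j)))).integrable
  rw [integral_finsetSum _ fun i _ => integrable_finsetSum _ fun j _ => hi i j]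
  simp_rw [integral_finsetSum _ fun j _ => hi _ j, integral_const_mul, integral_coord_mul]
  simp [Matrix.trace]

lemma sum_mul_transpose_le (A : Matrix ι ι ℝ) :
    ∑ i, ∑ j, A i j * A j i ≤ frobSq A := by
  have h : ∑ i, ∑ j, A i j * A j i ≤ ∑ i, ∑ j, (A i j ^ 2 + A j i ^ 2) / 2 :=
    Finset.sum_le_sum fun i _ => Finset.sum_le_sum fun j _ => by
      nlinarith [sq_nonneg (A i j - A j i)]
  refine h.trans (le_of_eq ?_)
  simp_rw [← Finset.sum_div, Finset.sum_add_distrib]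
  rw [Finset.sum_comm (f := fun i j => A j i ^ 2)]
  unfold frobSq; ring

lemma integral_bilin_sq (A : Matrix ι ι ℝ) :
    ∫ w, bilin A w w ^ 2 ∂gaussVec ι
      = A.trace ^ 2 + frobSq A + ∑ i, ∑ j, A i j * A j i := by
  classical
  have e : ∀ w : ι → ℝ, bilin A w w ^ 2
      = ∑ i, ∑ j, ∑ k, ∑ l, (A i j * A k l) * (w i * w j * (w k * w l)) := by
    intro w
    simp only [sq, bilin, Finset.sum_mul, Finset.mul_sum]
    refine Finset.sum_congr rfl fun i _ => Finset.sum_congr rfl fun j _ =>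
      Finset.sum_congr rfl fun k _ => Finset.sum_congr rfl fun l _ => by ring
  have hi : ∀ i j k l, Integrable
      (fun w : ι → ℝ => (A i j * A k l) * (w i * w j * (w k * w l))) (gaussVec ι) :=
    fun i j k l => ((AllMoments.const _).mul (((allMoments_coord i).mul (allMoments_coord j)).mul
      ((allMoments_coord k).mul (allMoments_coord l)))).integrable
  simp_rw [e]
  rw [integral_finsetSum _ fun i _ => integrable_finsetSum _ fun j _ =>
    integrable_finsetSum _ fun k _ => integrable_finsetSum _ fun l _ => hi i j k l]
  simp_rw [integral_finsetSum _ fun j _ => integrable_finsetSum _ fun k _ =>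
    integrable_finsetSum _ fun l _ => hi _ j k l,
    integral_finsetSum _ fun k _ => integrable_finsetSum _ fun l _ => hi _ _ k l,
    integral_finsetSum _ fun l _ => hi _ _ _ l, integral_const_mul, integral_coord_four, mul_add,
    Finset.sum_add_distrib]
  congr 1
  · congr 1
    · simp [Matrix.trace, sq, Finset.mul_sum, mul_comm]
    · simp [frobSq, sq]
  · simp

/-- The variance of a Gaussian quadratic form is `frobSq A` plus the sum of `A i j * A j i`, and the
latter is at most `frobSq A`; no symmetry of `A` is needed. -/
lemma integral_bilin_sub_trace_sq_le (A : Matrix ι ι ℝ) :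
    ∫ w, (bilin A w w - A.trace) ^ 2 ∂gaussVec ι ≤ 2 * frobSq A := by
  have e : ∀ w : ι → ℝ, (bilin A w w - A.trace) ^ 2
      = bilin A w w ^ 2 - 2 * A.trace * bilin A w w + A.trace ^ 2 := fun w => by ring
  simp_rw [e]
  rw [integral_add, integral_sub, integral_const_mul, integral_bilin, integral_bilin_sq]
  · have := sum_mul_transpose_le A
    simp; linarith
  · exact ((allMoments_bilin A).pow 2).integrable
  · exact (allMoments_bilin A).integrable.const_mul _
  · exact (((allMoments_bilin A).pow 2).integrable).sub ((allMoments_bilin A).integrable.const_mul _)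
  · exact integrable_const _

lemma integral_dot_sq_mul_dot_sq_le (u v : ι → ℝ) :
    ∫ w, dotProduct w u ^ 2 * dotProduct w v ^ 2 ∂gaussVec ι
      ≤ 3 * (dotProduct u u * dotProduct v v) := by
  have h := integral_dot_four u u v v
  have e : ∀ w : ι → ℝ, dotProduct w u ^ 2 * dotProduct w v ^ 2
    = dotProduct w u * dotProduct w u * (dotProduct w v * dotProduct w v) := fun w => by ring
  simp_rw [e, h]
  have cs : dotProduct u v ^ 2 ≤ dotProduct u u * dotProduct v v := by
    simp only [dotProduct, ← sq]
    exact Finset.sum_mul_sq_le_sq_mul_sq _ _ _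
  nlinarith

end

/-! ### Matrices with i.i.d. standard normal entries -/

/-- The law of an `m × n` matrix with i.i.d. standard normal entries, given by its rows. -/
def gaussMat (m n : ℕ) : Measure (Fin m → Fin n → ℝ) :=
  Measure.pi fun _ => gaussVec (Fin n)

instance (m n : ℕ) : IsProbabilityMeasure (gaussMat m n) := by
  unfold gaussMat; infer_instance

section

variable {m n : ℕ}

lemma measurePreserving_row (i : Fin m) :
    MeasurePreserving (fun W : Fin m → Fin n → ℝ => W i) (gaussMat m n) (gaussVec (Fin n)) :=
  measurePreserving_eval (fun _ : Fin m => gaussVec (Fin n)) i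

lemma allMoments_entry (i : Fin m) (k : Fin n) :
    AllMoments (fun W : Fin m → Fin n → ℝ => W i k) (gaussMat m n) :=
  (allMoments_coord k).comp (measurePreserving_row i)

/-- Distinct rows are independent, so the fourth-order expectation factors and only the diagonal
pairings survive. Without the trace term of the equal-row case, off-diagonal entries stay small. -/
lemma integral_bilin_rows_of_ne (A : Matrix (Fin n) (Fin n) ℝ) {i j : Fin m} (hij : i ≠ j) :
    ∫ W, bilin A (W i) (W j) ^ 2 ∂gaussMat m n = frobSq A := by
  have e : ∀ W : Fin m → Fin n → ℝ, bilin A (W i) (W j) ^ 2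
      = ∑ p, ∑ q, ∑ k, ∑ l, (A p q * A k l) * ((W i p * W i k) * (W j q * W j l)) := by
    intro w
    simp only [sq, bilin, Finset.sum_mul, Finset.mul_sum]
    refine Finset.sum_congr rfl fun i _ => Finset.sum_congr rfl fun j _ =>
      Finset.sum_congr rfl fun k _ => Finset.sum_congr rfl fun l _ => by ring
  have hi : ∀ p q k l, Integrable (fun W : Fin m → Fin n → ℝ =>
      (A p q * A k l) * ((W i p * W i k) * (W j q * W j l))) (gaussMat m n) :=
    fun p q k l => ((AllMoments.const _).mul (((allMoments_entry i p).mul (allMoments_entry i k)).mul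
      ((allMoments_entry j q).mul (allMoments_entry j l)))).integrable
  have hrow : ∀ (i : Fin m) (p k : Fin n), ∫ W, W i p * W i k ∂gaussMat m n
      = if p = k then 1 else 0 := by
    intro i p k
    rw [← integral_coord_mul p k, ← (measurePreserving_row (m := m) (n := n) i).map_eq,
      integral_map (measurable_pi_apply _).aemeasurable (by fun_prop)]
  have hind : IndepFun (fun W : Fin m → Fin n → ℝ => W i) (fun W => W j) (gaussMat m n) :=
    (iIndepFun_pi (μ := fun _ : Fin m => gaussVec (Fin n)) (X := fun _ w => w)
      fun _ => by fun_prop).indepFun hij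
  have h4 : ∀ p q k l : Fin n, ∫ W, (W i p * W i k) * (W j q * W j l) ∂gaussMat m n
      = (if p = k then 1 else 0) * (if q = l then 1 else 0) := by
    intro p q k l
    have := (hind.comp (φ := fun w : Fin n → ℝ => w p * w k) (ψ := fun w : Fin n → ℝ => w q * w l)
      (by fun_prop) (by fun_prop)).integral_fun_mul_eq_mul_integral (by fun_prop) (by fun_prop)
    simp only [Function.comp_def] at this
    rw [this, hrow, hrow]
  simp_rw [e]
  rw [integral_finsetSum _ fun i _ => integrable_finsetSum _ fun j _ =>
    integrable_finsetSum _ fun k _ => integrable_finsetSum _ fun l _ => hi i j k l]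
  simp_rw [integral_finsetSum _ fun j _ => integrable_finsetSum _ fun k _ =>
    integrable_finsetSum _ fun l _ => hi _ j k l,
    integral_finsetSum _ fun k _ => integrable_finsetSum _ fun l _ => hi _ _ k l,
    integral_finsetSum _ fun l _ => hi _ _ _ l, integral_const_mul, h4]
  simp [frobSq, sq]

lemma integral_bilin_rows_le (A : Matrix (Fin n) (Fin n) ℝ) (i j : Fin m) :
    ∫ W, bilin A (W i) (W j) ^ 2 ∂gaussMat m n
      ≤ frobSq A + if i = j then A.trace ^ 2 + frobSq A else 0 := by
  split_ifs with h
  · subst h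
    have h1 : ∫ W, bilin A (W i) (W i) ^ 2 ∂gaussMat m n
        = ∫ w, bilin A w w ^ 2 ∂gaussVec (Fin n) := by
      have hm : Measurable fun w : Fin n → ℝ => bilin A w w ^ 2 := by unfold bilin; fun_prop
      rw [← (measurePreserving_row (m := m) (n := n) i).map_eq,
        integral_map (measurable_pi_apply _).aemeasurable hm.aestronglyMeasurable]
    rw [h1, integral_bilin_sq]
    have := sum_mul_transpose_le A
    linarith
  · rw [integral_bilin_rows_of_ne A h, add_zero]

/-- Chebyshev's inequality for the average of i.i.d. functions of the rows of a Gaussian matrix. -/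
lemma gaussMat_average_le {φ : (Fin n → ℝ) → ℝ} (hφ : MemLp φ 2 (gaussVec (Fin n)))
    (hm : 0 < m) {ε : ℝ} (hε : 0 < ε) :
    gaussMat m n {W | ε ≤ |(∑ i, φ (W i)) / m - ∫ w, φ w ∂gaussVec (Fin n)|}
      ≤ ENNReal.ofReal ((∫ w, φ w ^ 2 ∂gaussVec (Fin n)) / (m * ε ^ 2)) := by
  have hm' : (0 : ℝ) < m := by exact_mod_cast hm
  set X : (Fin m → Fin n → ℝ) → ℝ := fun W => ∑ i, φ (W i) with hX
  have hmem : ∀ i : Fin m, MemLp (fun W : Fin m → Fin n → ℝ => φ (W i)) 2 (gaussMat m n) :=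
    fun i => hφ.comp_measurePreserving (measurePreserving_row i)
  have hXmem : MemLp X 2 (gaussMat m n) := memLp_finsetSum _ fun i _ => hmem i
  have hvar : Var[X; gaussMat m n] = m * Var[φ; gaussVec (Fin n)] := by
    have := variance_sum_pi (μ := fun _ : Fin m => gaussVec (Fin n)) (X := fun _ => φ) fun _ => hφ
    have e : X = ∑ i, fun W : Fin m → Fin n → ℝ => φ (W i) := by ext W; simp [hX]
    rw [e]
    unfold gaussMat
    rw [this]; simp
  have hmean : ∫ W, X W ∂gaussMat m n = m * ∫ w, φ w ∂gaussVec (Fin n) := by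
    rw [hX, integral_finsetSum _ fun i _ => (hmem i).integrable (by norm_num)]
    have : ∀ i : Fin m, ∫ W, φ (W i) ∂gaussMat m n = ∫ w, φ w ∂gaussVec (Fin n) := by
      intro i
      have hr := measurePreserving_row (m := m) (n := n) i
      conv_rhs => rw [← hr.map_eq]
      rw [integral_map (measurable_pi_apply _).aemeasurable (by rw [hr.map_eq]; exact hφ.aestronglyMeasurable)]
    simp [this]
  have hc := meas_ge_le_variance_div_sq hXmem (c := m * ε) (by positivity)
  have hset : {W : Fin m → Fin n → ℝ | ε ≤ |(∑ i, φ (W i)) / m - ∫ w, φ w ∂gaussVec (Fin n)|}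
      = {W | m * ε ≤ |X W - ∫ W, X W ∂gaussMat m n|} := by
    ext W
    simp only [Set.mem_ofPred_eq, hmean]
    have : X W - m * ∫ w, φ w ∂gaussVec (Fin n)
        = m * ((∑ i, φ (W i)) / m - ∫ w, φ w ∂gaussVec (Fin n)) := by
      simp only [hX]; field_simp
    rw [this, abs_mul, abs_of_pos hm', mul_le_mul_iff_right₀ hm']
  rw [hset]
  refine hc.trans (ENNReal.ofReal_le_ofReal ?_)
  rw [hvar]
  have hv : Var[φ; gaussVec (Fin n)] ≤ ∫ w, φ w ^ 2 ∂gaussVec (Fin n) := by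
    have := variance_le_expectation_sq (μ := gaussVec (Fin n)) hφ.aestronglyMeasurable
    simpa using this
  rw [div_le_div_iff₀ (by positivity) (by positivity)]
  have := mul_le_mul_of_nonneg_left hv (show 0 ≤ (m : ℝ) * (m * ε ^ 2) by positivity)
  nlinarith

end

/-! ### The arc-cosine kernels -/

/-- The derivative of the ReLU, with value `0` at `0`. -/
def heaviside (z : ℝ) : ℝ := if 0 < z then 1 else 0

/-- The arc-cosine kernel of degree `0`. -/
def arcCos0 (ρ : ℝ) : ℝ := 1 - Real.arccos ρ / Real.pi

/-- The arc-cosine kernel of degree `1`. -/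
def arcCos1 (ρ : ℝ) : ℝ :=
  (Real.sin (Real.arccos ρ) + (Real.pi - Real.arccos ρ) * ρ) / Real.pi

lemma heaviside_mul_of_pos {a : ℝ} (ha : 0 < a) (z : ℝ) : heaviside (a * z) = heaviside z := by
  simp [heaviside, ha]

lemma relu_mul_of_nonneg {a : ℝ} (ha : 0 ≤ a) (z : ℝ) : relu (a * z) = a * relu z := by
  simp [relu, mul_max_of_nonneg _ _ ha]

lemma relu_eq_heaviside_mul (z : ℝ) : relu z = heaviside z * z := by
  unfold relu heaviside
  split_ifs with h
  · simp [h.le]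
  · simp [not_lt.1 h]

@[fun_prop]
lemma measurable_heaviside : Measurable heaviside :=
  Measurable.ite measurableSet_Ioi measurable_const measurable_const

@[fun_prop]
lemma measurable_relu : Measurable relu := measurable_const.max measurable_id

/-! ### Gaussian integrals on the plane in polar coordinates. -/

lemma integral_gaussian_plane (G : ℝ × ℝ → ℝ) :
    ∫ p, G p ∂(gaussianReal 0 1).prod (gaussianReal 0 1)
      = ∫ p : ℝ × ℝ, ((2 * Real.pi)⁻¹ * Real.exp (-(p.1 ^ 2 + p.2 ^ 2) / 2)) * G p := by
  rw [gaussianReal_of_var_ne_zero 0 one_ne_zero, prod_withDensity (by fun_prop) (by fun_prop),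
    integral_withDensity_eq_integral_toReal_smul (by fun_prop)
      (ae_of_all _ fun p => ENNReal.mul_lt_top gaussianPDF_lt_top gaussianPDF_lt_top)]
  refine integral_congr_ae (ae_of_all _ fun p => ?_)
  simp only [ENNReal.toReal_mul, toReal_gaussianPDF, gaussianPDFReal, smul_eq_mul, NNReal.coe_one,
    mul_one, sub_zero]
  congr 1
  rw [show ∀ a b c d : ℝ, a * b * (c * d) = (a * c) * (b * d) from fun a b c d => by ring,
    ← Real.exp_add, ← mul_inv, Real.mul_self_sqrt (by positivity)]
  congr 2; ring

lemma integral_radial (k : ℕ) :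
    ∫ r in Set.Ioi (0 : ℝ), r ^ (k + 1) * Real.exp (-r ^ 2 / 2)
      = (1 / 2 : ℝ) ^ (-((k : ℝ) + 2) / 2) * (1 / 2) * Real.Gamma (((k : ℝ) + 2) / 2) := by
  have h := integral_rpow_mul_exp_neg_mul_rpow (p := 2) (q := (k : ℝ) + 1) (b := 1 / 2)
    (by norm_num) (by have : (0 : ℝ) ≤ k := k.cast_nonneg
                      linarith) (by norm_num)
  rw [show (k : ℝ) + 1 + 1 = k + 2 by ring] at h
  rw [← h]
  refine setIntegral_congr_fun measurableSet_Ioi fun r _ => ?_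
  have e1 : r ^ ((k : ℝ) + 1) = r ^ (k + 1) := by
    rw [← Real.rpow_natCast]; push_cast; rfl
  have e2 : r ^ (2 : ℝ) = r ^ 2 := by rw [← Real.rpow_natCast]; norm_num
  simp only [e1, e2]
  congr 2; ring

/-- Integration of a positively homogeneous function against the Gaussian measure on the plane,
in polar coordinates. -/
lemma integral_gaussian_plane_homogeneous (k : ℕ) (G : ℝ × ℝ → ℝ)
    (hG : ∀ r : ℝ, 0 < r → ∀ x y, G (r * x, r * y) = r ^ k * G (x, y)) :
    ∫ p, G p ∂(gaussianReal 0 1).prod (gaussianReal 0 1)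
      = (2 * Real.pi)⁻¹ * (∫ r in Set.Ioi (0 : ℝ), r ^ (k + 1) * Real.exp (-r ^ 2 / 2))
        * ∫ t in Set.Ioo (-Real.pi) Real.pi, G (Real.cos t, Real.sin t) := by
  rw [integral_gaussian_plane, ← integral_comp_polarCoord_symm, mul_assoc,
    ← setIntegral_prod_mul, ← integral_const_mul]
  refine setIntegral_congr_fun (by exact polarCoord.open_target.measurableSet) fun p hp => ?_
  have hp0 : 0 < p.1 := hp.1
  simp only [polarCoord_symm_apply, smul_eq_mul, hG p.1 hp0]
  have : (p.1 * Real.cos p.2) ^ 2 + (p.1 * Real.sin p.2) ^ 2 = p.1 ^ 2 := by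
    rw [mul_pow, mul_pow, ← mul_add, Real.cos_sq_add_sin_sq, mul_one]
  rw [this]
  ring

lemma heaviside_cos_mul {θ t : ℝ} (h0 : 0 ≤ θ) (h1 : θ ≤ Real.pi)
    (ht : t ∈ Set.Ioo (-Real.pi) Real.pi) :
    heaviside (Real.cos t) * heaviside (Real.cos (t - θ))
      = Set.indicator (Set.Ioo (θ - Real.pi / 2) (Real.pi / 2)) 1 t := by
  have hpi := Real.pi_pos
  by_cases hmem : t ∈ Set.Ioo (θ - Real.pi / 2) (Real.pi / 2)
  · have c1 : 0 < Real.cos t := Real.cos_pos_of_mem_Ioo ⟨by linarith [hmem.1], hmem.2⟩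
    have c2 : 0 < Real.cos (t - θ) :=
      Real.cos_pos_of_mem_Ioo ⟨by linarith [hmem.1], by linarith [hmem.2]⟩
    simp [heaviside, c1, c2, hmem]
  · rw [Set.indicator_of_notMem hmem]
    by_cases h2 : t < Real.pi / 2
    · have h3 : t ≤ θ - Real.pi / 2 := by
        by_contra h; exact hmem ⟨not_le.1 h, h2⟩
      by_cases h4 : -(Real.pi / 2) < t
      · have : Real.cos (t - θ) ≤ 0 := by
          rw [← Real.cos_neg]
          exact Real.cos_nonpos_of_pi_div_two_le_of_le (by linarith) (by linarith)
        simp [heaviside, this.not_gt]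
      · have : Real.cos t ≤ 0 := by
          rw [← Real.cos_neg]
          exact Real.cos_nonpos_of_pi_div_two_le_of_le (by linarith) (by linarith [ht.1])
        simp [heaviside, this.not_gt]
    · have : Real.cos t ≤ 0 :=
        Real.cos_nonpos_of_pi_div_two_le_of_le (by linarith) (by linarith [ht.2])
      simp [heaviside, this.not_gt]

/-- The half-planes of directions making acute angles with `0` and with `θ` meet in an arc of length
`π - θ`; this arc is the source of both arc-cosine kernels. -/
lemma integral_angular {θ : ℝ} (h0 : 0 ≤ θ) (h1 : θ ≤ Real.pi) (g : ℝ → ℝ) :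
    ∫ t in Set.Ioo (-Real.pi) Real.pi,
        heaviside (Real.cos t) * heaviside (Real.cos (t - θ)) * g t
      = ∫ t in (θ - Real.pi / 2)..(Real.pi / 2), g t := by
  have hpi := Real.pi_pos
  have e : ∀ t ∈ Set.Ioo (-Real.pi) Real.pi,
      heaviside (Real.cos t) * heaviside (Real.cos (t - θ)) * g t
        = Set.indicator (Set.Ioo (θ - Real.pi / 2) (Real.pi / 2)) g t := by
    intro t ht
    rw [heaviside_cos_mul h0 h1 ht]
    by_cases h : t ∈ Set.Ioo (θ - Real.pi / 2) (Real.pi / 2) <;> simp [h]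
  rw [setIntegral_congr_fun measurableSet_Ioo e, setIntegral_indicator measurableSet_Ioo,
    Set.inter_eq_right.2 (Set.Ioo_subset_Ioo (by linarith) (by linarith)),
    intervalIntegral.integral_of_le (by linarith), integral_Ioc_eq_integral_Ioo]

lemma integral_cos_mul_cos_sub (θ : ℝ) :
    ∫ t in (θ - Real.pi / 2)..(Real.pi / 2), Real.cos t * Real.cos (t - θ)
      = (Real.sin θ + (Real.pi - θ) * Real.cos θ) / 2 := by
  have hd : ∀ t : ℝ, HasDerivAt (fun t => (t * Real.cos θ + Real.sin (2 * t - θ) / 2) / 2)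
      (Real.cos t * Real.cos (t - θ)) t := by
    intro t
    have h1 : HasDerivAt (fun t : ℝ => 2 * t - θ) 2 t := by
      simpa using ((hasDerivAt_id' t).const_mul 2).sub_const θ
    have := (((hasDerivAt_id' t).mul_const (Real.cos θ)).fun_add (h1.sin.div_const 2)).div_const 2
    convert! this using 1
    have e1 : Real.cos θ = Real.cos (t - (t - θ)) := by congr 1; ring
    have e2 : Real.cos (2 * t - θ) = Real.cos (t + (t - θ)) := by congr 1; ring
    rw [e1, e2, Real.cos_add, Real.cos_sub t (t - θ)]
    ring
  rw [intervalIntegral.integral_eq_sub_of_hasDerivAt (fun t _ => hd t)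
    (Continuous.intervalIntegrable (by fun_prop) _ _)]
  have e1 : Real.sin (2 * (Real.pi / 2) - θ) = Real.sin θ := by
    rw [show 2 * (Real.pi / 2) - θ = Real.pi - θ by ring, Real.sin_pi_sub]
  have e2 : Real.sin (2 * (θ - Real.pi / 2) - θ) = -Real.sin θ := by
    rw [show 2 * (θ - Real.pi / 2) - θ = θ - Real.pi by ring, Real.sin_sub_pi]
  rw [e1, e2]; ring

section

variable {ι : Type*} [Fintype ι]

/-- Expectations of functions of two linear functionals, as integrals over the plane. -/
lemma integral_comp_dot_pair (u v : ι → ℝ) (F : ℝ × ℝ → ℝ) (hF : Measurable F) (θ a b : ℝ)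
    (h1 : dotProduct u u = a ^ 2) (h2 : dotProduct v v = b ^ 2)
    (h3 : dotProduct u v = a * b * Real.cos θ) :
    ∫ w, F (dotProduct w u, dotProduct w v) ∂gaussVec ι
      = ∫ p : ℝ × ℝ, F (a * p.1, b * (p.1 * Real.cos θ + p.2 * Real.sin θ))
        ∂(gaussianReal 0 1).prod (gaussianReal 0 1) := by
  have hl := map_dot_pair_eq (u := u) (v := v) (u' := ![a, 0])
    (v' := ![b * Real.cos θ, b * Real.sin θ])
    (by rw [h1]; simp [dotProduct]; ring) (by rw [h3]; simp [dotProduct]; ring)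
    (by
      rw [h2]; simp only [dotProduct, Fin.sum_univ_two, Matrix.cons_val_zero, Matrix.cons_val_one]
      rw [← mul_one (b ^ 2), ← Real.cos_sq_add_sin_sq θ]; ring)
  have hp := measurePreserving_piFinTwo (fun _ : Fin 2 => gaussianReal 0 1)
  have h4 := integral_map (μ := gaussVec ι) (φ := fun w => (dotProduct w u, dotProduct w v))
    (by fun_prop) hF.aestronglyMeasurable
  rw [← h4, hl, integral_map (by fun_prop) hF.aestronglyMeasurable]
  have h5 : Measurable fun p : ℝ × ℝ =>
      F (a * p.1, b * (p.1 * Real.cos θ + p.2 * Real.sin θ)) := hF.comp (by fun_prop)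
  have hp' : (gaussianReal 0 1).prod (gaussianReal 0 1)
      = (gaussVec (Fin 2)).map (MeasurableEquiv.piFinTwo fun _ => ℝ) := hp.map_eq.symm
  rw [hp', integral_map (MeasurableEquiv.measurable _).aemeasurable h5.aestronglyMeasurable]
  refine integral_congr_ae (ae_of_all _ fun w => ?_)
  simp [dotProduct, mul_comm, mul_add, mul_left_comm]

/-- The cosine of the angle between two coefficient vectors. -/
def cosine (u v : ι → ℝ) : ℝ :=
  dotProduct u v / (Real.sqrt (dotProduct u u) * Real.sqrt (dotProduct v v))

lemma dotProduct_self_nonneg' (u : ι → ℝ) : 0 ≤ dotProduct u u :=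
  Finset.sum_nonneg fun i _ => mul_self_nonneg (u i)

lemma abs_cosine_le_one (u v : ι → ℝ) : |cosine u v| ≤ 1 := by
  have cs : dotProduct u v ^ 2 ≤ dotProduct u u * dotProduct v v := by
    simp only [dotProduct, ← sq]
    exact Finset.sum_mul_sq_le_sq_mul_sq _ _ _
  unfold cosine
  rw [abs_div, abs_of_nonneg (a := _ * _) (by positivity)]
  refine div_le_one_of_le₀ ?_ (by positivity)
  rw [← Real.sqrt_mul (dotProduct_self_nonneg' u)]
  exact Real.abs_le_sqrt cs

lemma dotProduct_eq_cosine {u v : ι → ℝ} (hu : 0 < dotProduct u u) (hv : 0 < dotProduct v v) :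
    dotProduct u v = Real.sqrt (dotProduct u u) * Real.sqrt (dotProduct v v)
      * Real.cos (Real.arccos (cosine u v)) := by
  have h := abs_le.1 (abs_cosine_le_one u v)
  rw [Real.cos_arccos h.1 h.2]
  unfold cosine
  have := Real.sqrt_pos.2 hu
  have := Real.sqrt_pos.2 hv
  field_simp

/-- Positivity of both norms matters: for a zero vector the left side is `0`, while `cosine` takes
the default value `0` and `arcCos0 0 = 1 / 2`. -/
lemma integral_heaviside_mul {u v : ι → ℝ} (hu : 0 < dotProduct u u) (hv : 0 < dotProduct v v) :
    ∫ w, heaviside (dotProduct w u) * heaviside (dotProduct w v) ∂gaussVec ι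
      = arcCos0 (cosine u v) / 2 := by
  set θ := Real.arccos (cosine u v) with hθ
  have hpi := Real.pi_pos
  rw [integral_comp_dot_pair u v (fun p => heaviside p.1 * heaviside p.2) (by fun_prop) θ _ _
    (Real.sq_sqrt hu.le).symm (Real.sq_sqrt hv.le).symm (dotProduct_eq_cosine hu hv)]
  simp only [heaviside_mul_of_pos (Real.sqrt_pos.2 hu), heaviside_mul_of_pos (Real.sqrt_pos.2 hv)]
  rw [integral_gaussian_plane_homogeneous 0
    (fun p => heaviside p.1 * heaviside (p.1 * Real.cos θ + p.2 * Real.sin θ)), integral_radial]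
  · have := integral_angular (Real.arccos_nonneg (cosine u v)) (Real.arccos_le_pi _) (fun _ => 1)
    simp only [mul_one, ← hθ, Real.cos_sub] at this
    rw [this]
    simp only [Nat.cast_zero, zero_add, intervalIntegral.integral_const, smul_eq_mul, mul_one]
    rw [show (2 : ℝ) / 2 = 1 by norm_num, show (-2 : ℝ) / 2 = -1 by norm_num, Real.Gamma_one,
      Real.rpow_neg_one, arcCos0, ← hθ]
    field_simp; ring
  · intro r hr x y
    simp only
    rw [show r * x * Real.cos θ + r * y * Real.sin θ = r * (x * Real.cos θ + y * Real.sin θ) by ring,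
      heaviside_mul_of_pos hr, heaviside_mul_of_pos hr]; simp

/-- Zero vectors are allowed here because the factor of norms vanishes together with the integrand.
-/
lemma integral_relu_mul (u v : ι → ℝ) :
    ∫ w, relu (dotProduct w u) * relu (dotProduct w v) ∂gaussVec ι
      = Real.sqrt (dotProduct u u) * Real.sqrt (dotProduct v v) * arcCos1 (cosine u v) / 2 := by
  have hpi := Real.pi_pos
  rcases (dotProduct_self_nonneg' u).eq_or_lt with hu | hu
  · have : u = 0 := dotProduct_self_eq_zero.1 hu.symm
    subst this; simp [relu]
  rcases (dotProduct_self_nonneg' v).eq_or_lt with hv | hv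
  · have : v = 0 := dotProduct_self_eq_zero.1 hv.symm
    subst this; simp [relu]
  set θ := Real.arccos (cosine u v) with hθ
  rw [integral_comp_dot_pair u v (fun p => relu p.1 * relu p.2) (by fun_prop) θ _ _
    (Real.sq_sqrt hu.le).symm (Real.sq_sqrt hv.le).symm (dotProduct_eq_cosine hu hv)]
  simp only [relu_mul_of_nonneg (Real.sqrt_nonneg _)]
  simp_rw [fun x y : ℝ => mul_mul_mul_comm (Real.sqrt (dotProduct u u)) x
    (Real.sqrt (dotProduct v v)) y]
  rw [integral_const_mul, integral_gaussian_plane_homogeneous 2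
    (fun p => relu p.1 * relu (p.1 * Real.cos θ + p.2 * Real.sin θ)), integral_radial]
  · have := integral_angular (Real.arccos_nonneg (cosine u v)) (Real.arccos_le_pi _)
      (fun t => Real.cos t * Real.cos (t - θ))
    rw [← hθ, integral_cos_mul_cos_sub] at this
    have e : ∀ t : ℝ, relu (Real.cos t) * relu (Real.cos t * Real.cos θ + Real.sin t * Real.sin θ)
        = heaviside (Real.cos t) * heaviside (Real.cos (t - θ))
          * (Real.cos t * Real.cos (t - θ)) := by
      intro t; rw [← Real.cos_sub, relu_eq_heaviside_mul, relu_eq_heaviside_mul]; ring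
    simp only [e]
    have h := abs_le.1 (abs_cosine_le_one u v)
    rw [this, arcCos1, ← hθ, hθ, Real.cos_arccos h.1 h.2]
    have g2 : Real.Gamma (((2 : ℕ) + 2) / 2) = 1 := by
      rw [show (((2 : ℕ) : ℝ) + 2) / 2 = 2 by norm_num, Real.Gamma_two]
    have g3 : (1 / 2 : ℝ) ^ (-(((2 : ℕ) : ℝ) + 2) / 2) = 4 := by
      rw [show -(((2 : ℕ) : ℝ) + 2) / 2 = ((-2 : ℤ) : ℝ) by norm_num, Real.rpow_intCast]; norm_num
    rw [g2, g3]
    field_simp; ring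
  · intro r hr x y
    simp only
    rw [show r * x * Real.cos θ + r * y * Real.sin θ = r * (x * Real.cos θ + y * Real.sin θ) by ring,
      relu_mul_of_nonneg hr.le, relu_mul_of_nonneg hr.le]; ring

end

lemma continuous_arcCos0 : Continuous arcCos0 := by unfold arcCos0; fun_prop

lemma continuous_arcCos1 : Continuous arcCos1 := by
  unfold arcCos1; fun_prop

lemma arcCos0_nonneg (ρ : ℝ) : 0 ≤ arcCos0 ρ :=
  sub_nonneg.2 (div_le_one_of_le₀ (Real.arccos_le_pi _) Real.pi_pos.le)

lemma arcCos1_one : arcCos1 1 = 1 := by simp [arcCos1, Real.pi_ne_zero]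

lemma arcCos0_one : arcCos0 1 = 1 := by simp [arcCos0]

/-! ### One random layer -/

/-- The next embedding, computed with the weight matrix `W`. -/
def stepVec {m n : ℕ} (W : Fin m → Fin n → ℝ) (a : Fin n → ℝ) : Fin m → ℝ :=
  fun i => Real.sqrt 2 / Real.sqrt m * relu (dotProduct (W i) a)

/-- The Gram matrix of the parameter gradients of the next embeddings of two inputs, in terms of
their current embeddings `a`, `b` and the current Gram matrix `A` of gradients. -/
def stepMat {m n : ℕ} (W : Fin m → Fin n → ℝ) (a b : Fin n → ℝ) (A : Matrix (Fin n) (Fin n) ℝ) :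
    Matrix (Fin m) (Fin m) ℝ :=
  Matrix.of fun i j => 2 / (m : ℝ) * (heaviside (dotProduct (W i) a) * heaviside (dotProduct (W j) b))
    * ((if i = j then dotProduct a b else 0) + bilin A (W i) (W j))

lemma sqrt_two_div_sqrt_mul_self (m : ℕ) :
    Real.sqrt 2 / Real.sqrt m * (Real.sqrt 2 / Real.sqrt m) = 2 / (m : ℝ) := by
  rw [div_mul_div_comm, Real.mul_self_sqrt (by norm_num), Real.mul_self_sqrt m.cast_nonneg]

lemma abs_relu_le (z : ℝ) : |relu z| ≤ |z| := by
  unfold relu; rw [abs_of_nonneg (le_max_left _ _)]; exact max_le (abs_nonneg _) (le_abs_self _)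

lemma heaviside_nonneg (z : ℝ) : 0 ≤ heaviside z := by unfold heaviside; split_ifs <;> norm_num

lemma heaviside_le_one (z : ℝ) : heaviside z ≤ 1 := by unfold heaviside; split_ifs <;> norm_num

lemma allMoments_relu_dot {ι : Type*} [Fintype ι] (u : ι → ℝ) :
    AllMoments (fun w => relu (dotProduct w u)) (gaussVec ι) :=
  (allMoments_dot u).mono (measurable_relu.comp (measurable_dot u)).aestronglyMeasurable
    fun _ => abs_relu_le _

lemma allMoments_heaviside_dot {ι : Type*} [Fintype ι] (u : ι → ℝ) :
    AllMoments (fun w => heaviside (dotProduct w u)) (gaussVec ι) :=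
  (AllMoments.const (1 : ℝ)).mono (measurable_heaviside.comp (measurable_dot u)).aestronglyMeasurable
    fun _ => by rw [abs_of_nonneg (heaviside_nonneg _), abs_one]; exact heaviside_le_one _

section

variable {m n : ℕ}

lemma dotProduct_stepVec (W : Fin m → Fin n → ℝ) (a b : Fin n → ℝ) :
    dotProduct (stepVec W a) (stepVec W b)
      = (∑ i, 2 * (relu (dotProduct (W i) a) * relu (dotProduct (W i) b))) / m := by
  rw [Finset.sum_div]
  refine Finset.sum_congr rfl fun i _ => ?_
  have := sqrt_two_div_sqrt_mul_self m
  simp only [stepVec]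
  rw [mul_mul_mul_comm, this]; ring

/-- Chebyshev with second moment `12 = 2 ^ 2 * 3`: the ReLU is dominated by the identity in absolute
value, and the mixed fourth moment is at most `3` times the product of squared norms. The bound does
not see the dimension `n`. -/
lemma stepVec_concentration (a b : Fin n → ℝ) (hm : 0 < m) {ε : ℝ} (hε : 0 < ε) :
    gaussMat m n {W | ε ≤ |dotProduct (stepVec W a) (stepVec W b)
        - Real.sqrt (dotProduct a a) * Real.sqrt (dotProduct b b) * arcCos1 (cosine a b)|}
      ≤ ENNReal.ofReal (12 * (dotProduct a a * dotProduct b b) / (m * ε ^ 2)) := by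
  have hM : AllMoments (fun w => 2 * (relu (dotProduct w a) * relu (dotProduct w b)))
      (gaussVec (Fin n)) :=
    (AllMoments.const 2).mul ((allMoments_relu_dot a).mul (allMoments_relu_dot b))
  have h := gaussMat_average_le hM.memLp_two hm hε
  simp_rw [← dotProduct_stepVec] at h
  rw [integral_const_mul, integral_relu_mul] at h
  rw [mul_div_cancel₀ _ (two_ne_zero)] at h
  refine h.trans (ENNReal.ofReal_le_ofReal ?_)
  gcongr
  calc ∫ w, (2 * (relu (dotProduct w a) * relu (dotProduct w b))) ^ 2 ∂gaussVec (Fin n)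
      ≤ ∫ w, 4 * (dotProduct w a ^ 2 * dotProduct w b ^ 2) ∂gaussVec (Fin n) := by
        refine integral_mono (hM.pow 2).integrable ((AllMoments.const 4).mul
          (((allMoments_dot a).pow 2).mul ((allMoments_dot b).pow 2))).integrable fun w => ?_
        have h1 := sq_le_sq.2 (abs_relu_le (dotProduct w a))
        have h2 := sq_le_sq.2 (abs_relu_le (dotProduct w b))
        have := mul_le_mul h1 h2 (sq_nonneg _) (sq_nonneg _)
        simp only
        nlinarith
    _ ≤ 12 * (dotProduct a a * dotProduct b b) := by
        rw [integral_const_mul]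
        have := integral_dot_sq_mul_dot_sq_le a b
        linarith

lemma trace_stepMat (W : Fin m → Fin n → ℝ) (a b : Fin n → ℝ) (A : Matrix (Fin n) (Fin n) ℝ) :
    (stepMat W a b A).trace = (∑ i, 2 * (heaviside (dotProduct (W i) a)
      * heaviside (dotProduct (W i) b)) * (dotProduct a b + bilin A (W i) (W i))) / m := by
  rw [Finset.sum_div]
  refine Finset.sum_congr rfl fun i _ => ?_
  simp [stepMat]; ring

/-- This is nonnegativity of the variance of `|f|`. -/
lemma abs_integral_le_sqrt {Ω : Type*} [MeasurableSpace Ω] {μ : Measure Ω} [IsProbabilityMeasure μ]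
    {f : Ω → ℝ} (hf : MemLp f 2 μ) : ∫ x, |f x| ∂μ ≤ Real.sqrt (∫ x, f x ^ 2 ∂μ) := by
  refine Real.le_sqrt_of_sq_le ?_
  have h := variance_nonneg (fun x => |f x|) μ
  rw [variance_eq_sub (by simpa using! hf.abs)] at h
  simp only [Pi.pow_apply, sq_abs] at h
  linarith

/-- The activation indicators and the quadratic form share the row `W i`, so the expectation does
not factor. Replacing the form by its trace costs at most `2 * √(2 * frobSq A)` by Cauchy–Schwarz;
this deterministic bias is added to the threshold, and the rest is Chebyshev. -/
lemma stepMat_trace_concentration {a b : Fin n → ℝ} (ha : 0 < dotProduct a a)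
    (hb : 0 < dotProduct b b) (A : Matrix (Fin n) (Fin n) ℝ) (hm : 0 < m) {ε : ℝ} (hε : 0 < ε) :
    gaussMat m n {W | ε + 2 * Real.sqrt (2 * frobSq A) ≤ |(stepMat W a b A).trace
        - arcCos0 (cosine a b) * (dotProduct a b + A.trace)|}
      ≤ ENNReal.ofReal (4 * ((dotProduct a b + A.trace) ^ 2 + 2 * frobSq A) / (m * ε ^ 2)) := by
  set s := dotProduct a b with hs
  set H : (Fin n → ℝ) → ℝ := fun w => heaviside (dotProduct w a) * heaviside (dotProduct w b) with hH
  have hH0 : ∀ w, 0 ≤ H w := fun w => mul_nonneg (heaviside_nonneg _) (heaviside_nonneg _)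
  have hH1 : ∀ w, H w ≤ 1 := fun w =>
    mul_le_one₀ (heaviside_le_one _) (heaviside_nonneg _) (heaviside_le_one _)
  have hHM : AllMoments H (gaussVec (Fin n)) :=
    (allMoments_heaviside_dot a).mul (allMoments_heaviside_dot b)
  have hqM : AllMoments (fun w => s + bilin A w w) (gaussVec (Fin n)) :=
    (AllMoments.const s).add (allMoments_bilin A)
  have hdM : AllMoments (fun w => bilin A w w - A.trace) (gaussVec (Fin n)) :=
    (allMoments_bilin A).sub (AllMoments.const _)
  have hM : AllMoments (fun w => 2 * H w * (s + bilin A w w)) (gaussVec (Fin n)) :=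
    ((AllMoments.const 2).mul hHM).mul hqM
  have hvar := integral_bilin_sub_trace_sq_le A
  have h := gaussMat_average_le hM.memLp_two hm hε
  have hmean : |(∫ w, 2 * H w * (s + bilin A w w) ∂gaussVec (Fin n))
      - arcCos0 (cosine a b) * (s + A.trace)| ≤ 2 * Real.sqrt (2 * frobSq A) := by
    have e : ∀ w, 2 * H w * (s + bilin A w w)
        = 2 * (s + A.trace) * H w + 2 * (H w * (bilin A w w - A.trace)) := fun w => by ring
    simp_rw [e]
    rw [integral_add (hHM.integrable.const_mul _) ((hHM.mul hdM).integrable.const_mul _),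
      integral_const_mul, integral_const_mul, integral_heaviside_mul ha hb,
      show ∀ x y z : ℝ, 2 * x * (y / 2) + 2 * z - y * x = 2 * z from fun x y z => by ring,
      abs_mul, abs_two]
    refine mul_le_mul_of_nonneg_left ?_ zero_le_two
    calc |∫ w, H w * (bilin A w w - A.trace) ∂gaussVec (Fin n)|
        ≤ ∫ w, |H w * (bilin A w w - A.trace)| ∂gaussVec (Fin n) := abs_integral_le_integral_abs
      _ ≤ ∫ w, |bilin A w w - A.trace| ∂gaussVec (Fin n) := by
          refine integral_mono (hHM.mul hdM).integrable.abs hdM.integrable.abs fun w => ?_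
          simp only [abs_mul, abs_of_nonneg (hH0 w)]
          exact mul_le_of_le_one_left (abs_nonneg _) (hH1 w)
      _ ≤ Real.sqrt (∫ w, (bilin A w w - A.trace) ^ 2 ∂gaussVec (Fin n)) :=
          abs_integral_le_sqrt hdM.memLp_two
      _ ≤ Real.sqrt (2 * frobSq A) := Real.sqrt_le_sqrt hvar
  have hsecond : ∫ w, (2 * H w * (s + bilin A w w)) ^ 2 ∂gaussVec (Fin n)
      ≤ 4 * ((s + A.trace) ^ 2 + 2 * frobSq A) := by
    calc ∫ w, (2 * H w * (s + bilin A w w)) ^ 2 ∂gaussVec (Fin n)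
        ≤ ∫ w, 4 * (s + bilin A w w) ^ 2 ∂gaussVec (Fin n) := by
          refine integral_mono (hM.pow 2).integrable ((AllMoments.const 4).mul
            (hqM.pow 2)).integrable fun w => ?_
          have h1 : H w ^ 2 ≤ 1 := pow_le_one₀ (hH0 w) (hH1 w)
          have := mul_le_mul_of_nonneg_right h1 (sq_nonneg (s + bilin A w w))
          simp only
          nlinarith
      _ = 4 * ∫ w, ((s + A.trace) ^ 2 + 2 * (s + A.trace) * (bilin A w w - A.trace)
            + (bilin A w w - A.trace) ^ 2) ∂gaussVec (Fin n) := by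
          rw [integral_const_mul]
          congr 1
          refine integral_congr_ae (ae_of_all _ fun w => ?_)
          simp only; ring
      _ ≤ _ := by
          rw [integral_add
            ((AllMoments.const _).add ((AllMoments.const _).mul hdM)).integrable
            (hdM.pow 2).integrable, integral_add (integrable_const _) (hdM.integrable.const_mul _),
            integral_const_mul, integral_sub (allMoments_bilin A).integrable (integrable_const _),
            integral_bilin]
          simp only [integral_const, probReal_univ, smul_eq_mul, one_mul, sub_self, mul_zero,
            add_zero]
          linarith
  calc _ ≤ gaussMat m n {W | ε ≤ |(∑ i, 2 * H (W i) * (s + bilin A (W i) (W i))) / m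
          - ∫ w, 2 * H w * (s + bilin A w w) ∂gaussVec (Fin n)|} := by
        refine measure_mono fun W hW => ?_
        simp only [Set.mem_ofPred_eq, trace_stepMat] at hW ⊢
        have := abs_sub_le ((∑ i, 2 * H (W i) * (s + bilin A (W i) (W i))) / m)
          (∫ w, 2 * H w * (s + bilin A w w) ∂gaussVec (Fin n))
          (arcCos0 (cosine a b) * (s + A.trace))
        linarith
    _ ≤ _ := h.trans (ENNReal.ofReal_le_ofReal (by gcongr))

/-- The indicators are at most `1`, and `(x + y) ^ 2 ≤ 2 * (x ^ 2 + y ^ 2)` turns the prefactor `(2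
/ m) ^ 2` into `8 / m ^ 2`. -/
lemma frobSq_stepMat_le (W : Fin m → Fin n → ℝ) (a b : Fin n → ℝ) (A : Matrix (Fin n) (Fin n) ℝ) :
    frobSq (stepMat W a b A) ≤ ∑ i, ∑ j, 8 / (m : ℝ) ^ 2
      * ((if i = j then dotProduct a b ^ 2 else 0) + bilin A (W i) (W j) ^ 2) := by
  refine Finset.sum_le_sum fun i _ => Finset.sum_le_sum fun j _ => ?_
  simp only [stepMat, Matrix.of_apply]
  set H := heaviside (dotProduct (W i) a) * heaviside (dotProduct (W j) b)
  have h0 : 0 ≤ H := mul_nonneg (heaviside_nonneg _) (heaviside_nonneg _)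
  have h1 : H ≤ 1 := mul_le_one₀ (heaviside_le_one _) (heaviside_nonneg _) (heaviside_le_one _)
  have h2 : H ^ 2 ≤ 1 := pow_le_one₀ h0 h1
  set x : ℝ := if i = j then dotProduct a b else 0 with hx
  have hx2 : (if i = j then dotProduct a b ^ 2 else 0) = x ^ 2 := by
    rw [hx]; split_ifs <;> simp
  rw [hx2, mul_pow, mul_pow, div_pow]
  set y := bilin A (W i) (W j)
  have h3 : (x + y) ^ 2 ≤ 2 * (x ^ 2 + y ^ 2) := by nlinarith [sq_nonneg (x - y)]
  calc (2 : ℝ) ^ 2 / (m : ℝ) ^ 2 * H ^ 2 * (x + y) ^ 2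
      ≤ 2 ^ 2 / (m : ℝ) ^ 2 * 1 * (2 * (x ^ 2 + y ^ 2)) := by gcongr
    _ = 8 / (m : ℝ) ^ 2 * (x ^ 2 + y ^ 2) := by ring

lemma allMoments_bilin_rows (A : Matrix (Fin n) (Fin n) ℝ) (i j : Fin m) :
    AllMoments (fun W => bilin A (W i) (W j)) (gaussMat m n) :=
  AllMoments.sum fun k _ => AllMoments.sum fun l _ =>
    (AllMoments.const _).mul ((allMoments_entry i k).mul (allMoments_entry j l))

/-- Markov's inequality. The `m ^ 2` entries contribute order `frobSq A` in total; only the `m`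
diagonal ones see the trace and the inner product, and their share is of order `1 / m`. Hence
smallness of the Frobenius norm survives a layer. -/
lemma stepMat_frobSq_concentration (a b : Fin n → ℝ) (A : Matrix (Fin n) (Fin n) ℝ) (hm : 0 < m)
    {ε : ℝ} (hε : 0 < ε) :
    gaussMat m n {W | ε ≤ frobSq (stepMat W a b A)}
      ≤ ENNReal.ofReal (8 * (frobSq A + (dotProduct a b ^ 2 + A.trace ^ 2 + frobSq A) / m) / ε) := by
  have hm' : (0 : ℝ) < m := by exact_mod_cast hm
  set Y : (Fin m → Fin n → ℝ) → ℝ := fun W => ∑ i, ∑ j, 8 / (m : ℝ) ^ 2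
      * ((if i = j then dotProduct a b ^ 2 else 0) + bilin A (W i) (W j) ^ 2) with hY
  have hYi : ∀ i j : Fin m, Integrable (fun W : Fin m → Fin n → ℝ => 8 / (m : ℝ) ^ 2
      * ((if i = j then dotProduct a b ^ 2 else 0) + bilin A (W i) (W j) ^ 2)) (gaussMat m n) :=
    fun i j => ((integrable_const _).add ((allMoments_bilin_rows A i j).pow 2).integrable).const_mul _
  have hYint : Integrable Y (gaussMat m n) :=
    integrable_finsetSum _ fun i _ => integrable_finsetSum _ fun j _ => hYi i j
  have hY0 : ∀ W, 0 ≤ Y W := fun W => Finset.sum_nonneg fun i _ => Finset.sum_nonneg fun j _ => by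
    have : 0 ≤ (if i = j then dotProduct a b ^ 2 else 0) := by split_ifs <;> positivity
    positivity
  have hE : ∫ W, Y W ∂gaussMat m n
      ≤ 8 * (frobSq A + (dotProduct a b ^ 2 + A.trace ^ 2 + frobSq A) / m) := by
    rw [hY, integral_finsetSum _ fun i _ => integrable_finsetSum _ fun j _ => hYi i j]
    simp_rw [integral_finsetSum _ fun j _ => hYi _ j, integral_const_mul]
    calc _ ≤ ∑ i : Fin m, ∑ j : Fin m, 8 / (m : ℝ) ^ 2 * (frobSq A
          + if i = j then dotProduct a b ^ 2 + A.trace ^ 2 + frobSq A else 0) := by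
          refine Finset.sum_le_sum fun i _ => Finset.sum_le_sum fun j _ => ?_
          refine mul_le_mul_of_nonneg_left ?_ (by positivity)
          rw [integral_add (integrable_const _) ((allMoments_bilin_rows A i j).pow 2).integrable]
          have := integral_bilin_rows_le A i j
          simp only [integral_const, probReal_univ, smul_eq_mul, one_mul]
          split_ifs at this ⊢ <;> linarith
      _ = _ := by
          simp only [← Finset.mul_sum, Finset.sum_add_distrib, Finset.sum_ite_eq, Finset.mem_univ,
            if_true, Finset.sum_const, Finset.card_univ, Fintype.card_fin, nsmul_eq_mul]
          field_simp
  have hmk := mul_meas_ge_le_integral_of_nonneg (ae_of_all _ hY0) hYint ε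
  calc gaussMat m n {W | ε ≤ frobSq (stepMat W a b A)}
      ≤ gaussMat m n {W | ε ≤ Y W} :=
        measure_mono fun W hW => le_trans (α := ℝ) hW (frobSq_stepMat_le W a b A)
    _ = ENNReal.ofReal ((gaussMat m n).real {W | ε ≤ Y W}) := by
        rw [Measure.real, ENNReal.ofReal_toReal (measure_ne_top _ _)]
    _ ≤ _ := ENNReal.ofReal_le_ofReal (by
        rw [le_div_iff₀ hε]; linarith)

end

/-! ### Propagation of limits through one layer -/

/-- The inner products of the embeddings `a`, `b` and the trace of `A` are `η`-close to the given
values, and the squared Frobenius norm of `A` is less than `η`. -/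
structure LayerNear (η P Q R T : ℝ) {n : ℕ} (a b : Fin n → ℝ) (A : Matrix (Fin n) (Fin n) ℝ) :
    Prop where
  left : |dotProduct a a - P| < η
  right : |dotProduct b b - Q| < η
  inner : |dotProduct a b - R| < η
  trace : |A.trace - T| < η
  frob : frobSq A < η

lemma LayerNear.mono {η η' P Q R T : ℝ} {n : ℕ} {a b : Fin n → ℝ} {A : Matrix (Fin n) (Fin n) ℝ}
    (h : LayerNear η P Q R T a b A) (hη : η ≤ η') : LayerNear η' P Q R T a b A :=
  ⟨h.left.trans_le hη, h.right.trans_le hη, h.inner.trans_le hη, h.trace.trans_le hη,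
    h.frob.trans_le hη⟩

lemma gaussVec_dot_eq_zero {ι : Type*} [Fintype ι] {u : ι → ℝ} (hu : 0 < dotProduct u u) :
    gaussVec ι {w | dotProduct w u = 0} = 0 := by
  have hl := map_dot_pair_eq (u := u) (v := u)
    (u' := fun _ : Unit => Real.sqrt (dotProduct u u))
    (v' := fun _ : Unit => Real.sqrt (dotProduct u u))
    (by simp [dotProduct]; exact (Real.mul_self_sqrt hu.le).symm)
    (by simp [dotProduct]; exact (Real.mul_self_sqrt hu.le).symm)
    (by simp [dotProduct]; exact (Real.mul_self_sqrt hu.le).symm)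
  have hS : MeasurableSet {p : ℝ × ℝ | p.1 = 0} := measurable_fst (measurableSet_singleton 0)
  have h1 := Measure.map_apply (μ := gaussVec ι) (f := fun w => (dotProduct w u, dotProduct w u))
    (by fun_prop) hS
  rw [hl, Measure.map_apply (by fun_prop) hS] at h1
  have e1 : (fun w : ι → ℝ => (dotProduct w u, dotProduct w u)) ⁻¹' {p : ℝ × ℝ | p.1 = 0}
      = {w | dotProduct w u = 0} := rfl
  rw [← e1, ← h1]
  have e2 : (fun w : Unit → ℝ => (dotProduct w fun _ => Real.sqrt (dotProduct u u),
      dotProduct w fun _ => Real.sqrt (dotProduct u u))) ⁻¹' {p : ℝ × ℝ | p.1 = 0}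
      = (fun w : Unit → ℝ => w ()) ⁻¹' {0} := by
    ext w
    have hs := (Real.sqrt_pos.2 hu).ne'
    have hd : ∀ c : ℝ, dotProduct w (fun _ => c) = w () * c := fun c => by simp [dotProduct]
    simp only [Set.mem_preimage, Set.mem_ofPred_eq, hd, mul_eq_zero, hs, or_false,
      Set.mem_singleton_iff]
  rw [e2, gaussVec, (measurePreserving_eval (fun _ : Unit => gaussianReal 0 1) ()).measure_preimage
    (measurableSet_singleton 0).nullMeasurableSet]
  have := nullSingletonClass_gaussianReal (μ := 0) (v := 1) one_ne_zero
  simp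

/-- Almost surely no preactivation sits at the kink of the ReLU, which makes the network
differentiable in its parameters there. -/
lemma gaussMat_exists_dot_eq_zero {m n : ℕ} {a : Fin n → ℝ} (ha : 0 < dotProduct a a) :
    gaussMat m n {W | ∃ i, dotProduct (W i) a = 0} = 0 := by
  rw [Set.ofPred_exists]
  refine measure_iUnion_null fun i => ?_
  have hS : MeasurableSet {w : Fin n → ℝ | dotProduct w a = 0} :=
    measurable_dot a (measurableSet_singleton 0)
  exact ((measurePreserving_row i).measure_preimage hS.nullMeasurableSet).trans
    (gaussVec_dot_eq_zero ha)

lemma sqrt_mul_sqrt_mul_arcCos1_cosine_self {ι : Type*} [Fintype ι] (a : ι → ℝ) :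
    Real.sqrt (dotProduct a a) * Real.sqrt (dotProduct a a) * arcCos1 (cosine a a)
      = dotProduct a a := by
  have h := dotProduct_self_nonneg' a
  unfold cosine
  rw [Real.mul_self_sqrt h]
  rcases h.eq_or_lt with h0 | h0
  · simp [← h0]
  · rw [div_self h0.ne', arcCos1_one, mul_one]

/-- The limit of the inner product of the embeddings in the next layer. -/
def nextInner (P Q R : ℝ) : ℝ :=
  Real.sqrt P * Real.sqrt Q * arcCos1 (R / (Real.sqrt P * Real.sqrt Q))

/-- The limit of the trace of the Gram matrix of gradients in the next layer. -/
def nextTrace (P Q R T : ℝ) : ℝ := arcCos0 (R / (Real.sqrt P * Real.sqrt Q)) * (R + T)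

lemma eventually_div_nat_le (C : ℝ) {ε : ℝ} (hε : 0 < ε) : ∀ᶠ m : ℕ in atTop, C / m ≤ ε :=
  ((tendsto_const_div_atTop_nhds_zero_nat C).eventually (gt_mem_nhds hε)).mono fun _ h => h.le

/-- One layer maps near-limit data to near-limit data with high probability. Neither `δ` nor the
threshold on `m` depends on `n`, so the same statement serves the first layer (`n = d`) and the
later ones (`n = m`). The values `P`, `Q` are preserved since `arcCos1 1 = 1`. -/
lemma layerNear_step {P Q : ℝ} (R T : ℝ) (hP : 0 < P) (hQ : 0 < Q) {ε : ℝ} (hε : 0 < ε) :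
    ∃ δ : ℝ, 0 < δ ∧ ∀ᶠ m : ℕ in atTop, ∀ (n : ℕ) (a b : Fin n → ℝ) (A : Matrix (Fin n) (Fin n) ℝ),
      LayerNear δ P Q R T a b A →
      gaussMat m n {W | ¬ (LayerNear ε P Q (nextInner P Q R) (nextTrace P Q R T)
        (stepVec W a) (stepVec W b) (stepMat W a b A) ∧
        ∀ i, dotProduct (W i) a ≠ 0 ∧ dotProduct (W i) b ≠ 0)} ≤ ENNReal.ofReal ε := by
  have hne : Real.sqrt P * Real.sqrt Q ≠ 0 :=
    mul_ne_zero (Real.sqrt_pos.2 hP).ne' (Real.sqrt_pos.2 hQ).ne'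
  -- The limit point of the five tracked quantities; the last coordinate is the limiting squared
  -- Frobenius norm. Everything required of the current layer is an open condition holding at this
  -- point.
  set x₀ : ℝ × ℝ × ℝ × ℝ × ℝ := (P, Q, R, T, 0) with hx₀
  have c1 : ContinuousAt (fun x : ℝ × ℝ × ℝ × ℝ × ℝ => nextInner x.1 x.2.1 x.2.2.1) x₀ := by
    unfold nextInner
    refine ContinuousAt.mul (by fun_prop) (continuous_arcCos1.continuousAt.comp ?_)
    exact ContinuousAt.div (by fun_prop) (by fun_prop) hne
  have c2 : ContinuousAt (fun x : ℝ × ℝ × ℝ × ℝ × ℝ => nextTrace x.1 x.2.1 x.2.2.1 x.2.2.2.1) x₀ := by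
    unfold nextTrace
    refine ContinuousAt.mul (continuous_arcCos0.continuousAt.comp ?_) (by fun_prop)
    exact ContinuousAt.div (by fun_prop) (by fun_prop) hne
  -- A single constant above every moment that enters the tail bounds; the `+ 1` makes the
  -- inequalities strict at `x₀`, hence valid nearby.
  obtain ⟨D, hD⟩ : ∃ D : ℝ, D = P * P + Q * Q + P * Q + (R + T) ^ 2 + R ^ 2 + T ^ 2 + 1 := ⟨_, rfl⟩
  have hPP := mul_pos hP hP
  have hQQ := mul_pos hQ hQ
  have hPQ := mul_pos hP hQ
  have hR2 := sq_nonneg R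
  have hT2 := sq_nonneg T
  have hRT := sq_nonneg (R + T)
  have lt_of_cont : ∀ {F : ℝ × ℝ × ℝ × ℝ × ℝ → ℝ} {c : ℝ}, Continuous F → F x₀ < c →
      ∀ᶠ x in 𝓝 x₀, F x < c := fun hF h => hF.continuousAt.eventually (gt_mem_nhds h)
  have hev : ∀ᶠ x in 𝓝 x₀, (0 < x.1 ∧ 0 < x.2.1 ∧ |x.1 - P| < ε / 2 ∧ |x.2.1 - Q| < ε / 2) ∧
      (|nextInner x.1 x.2.1 x.2.2.1 - nextInner P Q R| < ε / 2 ∧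
      |nextTrace x.1 x.2.1 x.2.2.1 x.2.2.2.1 - nextTrace P Q R T| < ε / 4) ∧
      (2 * Real.sqrt (2 * x.2.2.2.2) < ε / 4 ∧ 8 * x.2.2.2.2 / ε < ε / 16) ∧
      (x.1 * x.1 < D ∧ x.2.1 * x.2.1 < D ∧ x.1 * x.2.1 < D) ∧
      ((x.2.2.1 + x.2.2.2.1) ^ 2 + 2 * x.2.2.2.2 < D ∧
      x.2.2.1 ^ 2 + x.2.2.2.1 ^ 2 + x.2.2.2.2 < D) := by
    refine (Eventually.and ?_ (Eventually.and ?_ (Eventually.and ?_ ?_))).and ((Eventually.and ?_ ?_).and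
      ((Eventually.and ?_ ?_).and ((Eventually.and ?_ (Eventually.and ?_ ?_)).and
      (Eventually.and ?_ ?_))))
    · exact continuous_fst.continuousAt.eventually (lt_mem_nhds hP)
    · exact (continuous_fst.comp continuous_snd).continuousAt.eventually (lt_mem_nhds hQ)
    · exact lt_of_cont (F := fun x => |x.1 - P|) (by fun_prop) (by simp [hx₀, hε])
    · exact lt_of_cont (F := fun x => |x.2.1 - Q|) (by fun_prop) (by simp [hx₀, hε])
    · exact (c1.sub continuousAt_const).abs.eventually (gt_mem_nhds (by simp [hx₀, hε]))
    · exact (c2.sub continuousAt_const).abs.eventually (gt_mem_nhds (by simp [hx₀, hε]))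
    · exact lt_of_cont (F := fun x => 2 * Real.sqrt (2 * x.2.2.2.2)) (by fun_prop) (by simp [hx₀, hε])
    · exact lt_of_cont (F := fun x => 8 * x.2.2.2.2 / ε) (by fun_prop) (by simp [hx₀, hε])
    · exact lt_of_cont (F := fun x => x.1 * x.1) (by fun_prop) (by simp only [hx₀, hD]; linarith)
    · exact lt_of_cont (F := fun x => x.2.1 * x.2.1) (by fun_prop) (by simp only [hx₀, hD]; linarith)
    · exact lt_of_cont (F := fun x => x.1 * x.2.1) (by fun_prop) (by simp only [hx₀, hD]; linarith)
    · exact lt_of_cont (F := fun x => (x.2.2.1 + x.2.2.2.1) ^ 2 + 2 * x.2.2.2.2) (by fun_prop)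
        (by simp only [hx₀, hD]; linarith)
    · exact lt_of_cont (F := fun x => x.2.2.1 ^ 2 + x.2.2.2.1 ^ 2 + x.2.2.2.2) (by fun_prop)
        (by simp only [hx₀, hD]; linarith)
  obtain ⟨δ, hδ, hball⟩ := Metric.eventually_nhds_iff.1 hev
  refine ⟨δ, hδ, ?_⟩
  filter_upwards [eventually_gt_atTop 0, eventually_div_nat_le (12 * D / (ε / 2) ^ 2)
    (show 0 < ε / 8 by positivity), eventually_div_nat_le (4 * D / (ε / 4) ^ 2)
    (show 0 < ε / 8 by positivity), eventually_div_nat_le (8 * D / ε)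
    (show 0 < ε / 16 by positivity)] with m hm hm1 hm2 hm3
  intro n a b A hnear
  have hm' : (0 : ℝ) < m := by exact_mod_cast hm
  obtain ⟨⟨ha, hb, hpa, hqb⟩, ⟨hin, htr⟩, ⟨hf1, hf2⟩, ⟨d1, d2, d3⟩, ⟨d4, d5⟩⟩ :=
    hball (y := (dotProduct a a, dotProduct b b, dotProduct a b, A.trace, frobSq A)) (by
      simp only [hx₀, Prod.dist_eq, Real.dist_eq, max_lt_iff]
      exact ⟨hnear.left, hnear.right, hnear.inner, hnear.trace, by
        rw [sub_zero, abs_of_nonneg (frobSq_nonneg A)]; exact hnear.frob⟩)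
  simp only at ha hb hpa hqb hin htr hf1 hf2 d1 d2 d3 d4 d5
  have b1 := stepVec_concentration a a hm (ε := ε / 2) (by positivity)
  have b2 := stepVec_concentration b b hm (ε := ε / 2) (by positivity)
  have b3 := stepVec_concentration a b hm (ε := ε / 2) (by positivity)
  have b4 := stepMat_trace_concentration ha hb A hm (ε := ε / 4) (by positivity)
  have b5 := stepMat_frobSq_concentration a b A hm hε
  rw [sqrt_mul_sqrt_mul_arcCos1_cosine_self] at b1 b2
  have hsmall : ∀ X : ℝ, X < D → 12 * X / (m * (ε / 2) ^ 2) ≤ ε / 8 := by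
    intro X hX
    refine le_trans ?_ hm1
    rw [div_div, mul_comm ((ε / 2) ^ 2)]
    gcongr
  have s4 : 4 * ((dotProduct a b + A.trace) ^ 2 + 2 * frobSq A) / (m * (ε / 4) ^ 2) ≤ ε / 8 := by
    refine le_trans ?_ hm2
    rw [div_div, mul_comm ((ε / 4) ^ 2)]
    gcongr
  have s5 : 8 * (frobSq A + (dotProduct a b ^ 2 + A.trace ^ 2 + frobSq A) / m) / ε ≤ ε / 8 := by
    have e : 8 * (frobSq A + (dotProduct a b ^ 2 + A.trace ^ 2 + frobSq A) / m) / ε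
        = 8 * frobSq A / ε + 8 * (dotProduct a b ^ 2 + A.trace ^ 2 + frobSq A) / ε / m := by
      field_simp
    have : 8 * (dotProduct a b ^ 2 + A.trace ^ 2 + frobSq A) / ε / m ≤ 8 * D / ε / m := by gcongr
    rw [e]; linarith
  have t1 := b1.trans (ENNReal.ofReal_le_ofReal (hsmall _ d1))
  have t2 := b2.trans (ENNReal.ofReal_le_ofReal (hsmall _ d2))
  have t3 := b3.trans (ENNReal.ofReal_le_ofReal (hsmall _ d3))
  have t4 := b4.trans (ENNReal.ofReal_le_ofReal s4)
  have t5 := b5.trans (ENNReal.ofReal_le_ofReal s5)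
  have t6 := gaussMat_exists_dot_eq_zero (m := m) ha
  have t7 := gaussMat_exists_dot_eq_zero (m := m) hb
  set E1 := {W : Fin m → Fin n → ℝ | ε / 2 ≤ |dotProduct (stepVec W a) (stepVec W a) - dotProduct a a|}
  set E2 := {W : Fin m → Fin n → ℝ | ε / 2 ≤ |dotProduct (stepVec W b) (stepVec W b) - dotProduct b b|}
  set E3 := {W : Fin m → Fin n → ℝ | ε / 2 ≤ |dotProduct (stepVec W a) (stepVec W b)
    - Real.sqrt (dotProduct a a) * Real.sqrt (dotProduct b b) * arcCos1 (cosine a b)|} with hE3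
  set E4 := {W : Fin m → Fin n → ℝ | ε / 4 + 2 * Real.sqrt (2 * frobSq A) ≤ |(stepMat W a b A).trace
    - arcCos0 (cosine a b) * (dotProduct a b + A.trace)|} with hE4
  set E5 := {W : Fin m → Fin n → ℝ | ε ≤ frobSq (stepMat W a b A)}
  set E6 := {W : Fin m → Fin n → ℝ | ∃ i, dotProduct (W i) a = 0}
  set E7 := {W : Fin m → Fin n → ℝ | ∃ i, dotProduct (W i) b = 0}
  -- Five Chebyshev or Markov events, each of probability at most `ε / 8`, and two null events cover
  -- the failure event.
  have hsub : {W | ¬ (LayerNear ε P Q (nextInner P Q R) (nextTrace P Q R T)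
        (stepVec W a) (stepVec W b) (stepMat W a b A) ∧
        ∀ i, dotProduct (W i) a ≠ 0 ∧ dotProduct (W i) b ≠ 0)}
      ⊆ E1 ∪ E2 ∪ E3 ∪ E4 ∪ E5 ∪ (E6 ∪ E7) := by
    intro W hW
    by_contra hc
    simp only [Set.mem_union, not_or] at hc
    obtain ⟨⟨⟨⟨⟨h1, h2⟩, h3⟩, h4⟩, h5⟩, h6, h7⟩ := hc
    replace h1 : |dotProduct (stepVec W a) (stepVec W a) - dotProduct a a| < ε / 2 := lt_of_not_ge h1
    replace h2 : |dotProduct (stepVec W b) (stepVec W b) - dotProduct b b| < ε / 2 := lt_of_not_ge h2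
    replace h3 : |dotProduct (stepVec W a) (stepVec W b)
      - nextInner (dotProduct a a) (dotProduct b b) (dotProduct a b)| < ε / 2 := lt_of_not_ge h3
    replace h4 : |(stepMat W a b A).trace - nextTrace (dotProduct a a) (dotProduct b b)
      (dotProduct a b) A.trace| < ε / 4 + 2 * Real.sqrt (2 * frobSq A) := lt_of_not_ge h4
    refine hW ⟨⟨?_, ?_, ?_, ?_, lt_of_not_ge h5⟩, fun i => ⟨fun h => h6 ⟨i, h⟩, fun h => h7 ⟨i, h⟩⟩⟩
    · linarith [abs_sub_le (dotProduct (stepVec W a) (stepVec W a)) (dotProduct a a) P]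
    · linarith [abs_sub_le (dotProduct (stepVec W b) (stepVec W b)) (dotProduct b b) Q]
    · linarith [abs_sub_le (dotProduct (stepVec W a) (stepVec W b))
        (nextInner (dotProduct a a) (dotProduct b b) (dotProduct a b)) (nextInner P Q R)]
    · linarith [abs_sub_le (stepMat W a b A).trace
        (nextTrace (dotProduct a a) (dotProduct b b) (dotProduct a b) A.trace) (nextTrace P Q R T)]
  have h67 : gaussMat m n (E6 ∪ E7) = 0 := measure_union_null t6 t7
  calc _ ≤ gaussMat m n (E1 ∪ E2 ∪ E3 ∪ E4 ∪ E5 ∪ (E6 ∪ E7)) := measure_mono hsub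
    _ ≤ gaussMat m n E1 + gaussMat m n E2 + gaussMat m n E3 + gaussMat m n E4 + gaussMat m n E5
        + gaussMat m n (E6 ∪ E7) := by
      refine (measure_union_le _ _).trans (add_le_add ?_ le_rfl)
      refine (measure_union_le _ _).trans (add_le_add ?_ le_rfl)
      refine (measure_union_le _ _).trans (add_le_add ?_ le_rfl)
      refine (measure_union_le _ _).trans (add_le_add ?_ le_rfl)
      exact measure_union_le _ _
    _ ≤ ENNReal.ofReal (ε / 8) + ENNReal.ofReal (ε / 8) + ENNReal.ofReal (ε / 8)
        + ENNReal.ofReal (ε / 8) + ENNReal.ofReal (ε / 8) + 0 := by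
      rw [h67]; gcongr
    _ ≤ ENNReal.ofReal ε := by
      have h8 : 0 ≤ ε / 8 := by positivity
      rw [add_zero, ← ENNReal.ofReal_add h8 h8, ← ENNReal.ofReal_add (by positivity) h8,
        ← ENNReal.ofReal_add (by positivity) h8, ← ENNReal.ofReal_add (by positivity) h8]
      exact ENNReal.ofReal_le_ofReal (by linarith)

/-- Chebyshev's inequality for a Gaussian quadratic form. -/
lemma gaussVec_bilin_concentration {ι : Type*} [Fintype ι] (A : Matrix ι ι ℝ) {ε : ℝ} (hε : 0 < ε) :
    gaussVec ι {w | ε ≤ |bilin A w w - A.trace|} ≤ ENNReal.ofReal (2 * frobSq A / ε ^ 2) := by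
  have h := meas_ge_le_variance_div_sq (allMoments_bilin A).memLp_two hε
  rw [integral_bilin] at h
  refine h.trans (ENNReal.ofReal_le_ofReal ?_)
  gcongr
  rw [variance_eq_integral (allMoments_bilin A).memLp_two.aestronglyMeasurable.aemeasurable,
    integral_bilin]
  exact integral_bilin_sub_trace_sq_le A

/-! ### Gradients of the network -/

section

variable {d m L : ℕ}

lemma embedding_succ (w : Params d m L) (x : EuclideanSpace ℝ (Fin d)) (l : ℕ) (h : l + 1 ≤ L) :
    embedding w x (l + 1) h = stepVec (m := m) (n := width d m l) (hiddenWeight w ⟨l, h⟩)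
      (embedding w x l (Nat.le_of_succ_le h)) := rfl

/-- The Gram matrix of the parameter gradients of the `l`-embeddings of `x` and `y`. -/
def ntkAux (w : Params d m L) (x y : EuclideanSpace ℝ (Fin d)) :
    (l : ℕ) → l ≤ L → Matrix (Fin (width d m l)) (Fin (width d m l)) ℝ
  | 0, _ => 0
  | l + 1, h => stepMat (m := m) (n := width d m l) (hiddenWeight w ⟨l, h⟩)
      (embedding w x l (Nat.le_of_succ_le h)) (embedding w y l (Nat.le_of_succ_le h))
      (ntkAux w x y l (Nat.le_of_succ_le h))

/-- The parameter gradients of the entries of the `l`-embedding. -/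
def embGrad (w : Params d m L) (x : EuclideanSpace ℝ (Fin d)) :
    (l : ℕ) → l ≤ L → Fin (width d m l) → Params d m L
  | 0, _ => fun _ => 0
  | l + 1, h => fun i =>
      (Real.sqrt 2 / Real.sqrt m * heaviside ((hiddenWeight w ⟨l, h⟩).mulVec
        (embedding w x l (Nat.le_of_succ_le h)) i)) •
      ∑ k, (hiddenWeight w ⟨l, h⟩ i k • embGrad w x l (Nat.le_of_succ_le h) k
        + embedding w x l (Nat.le_of_succ_le h) k •
          EuclideanSpace.single (Sum.inl ⟨⟨l, h⟩, (i, k)⟩ : ParamIndex d m L) (1 : ℝ))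

/-- The preactivations of the layers before `l` at the input `x` are all nonzero. -/
def NonzeroPreact (w : Params d m L) (x : EuclideanSpace ℝ (Fin d)) (l : ℕ) : Prop :=
  ∀ (k : ℕ) (hk : k < L), k < l →
    ∀ i, (hiddenWeight w ⟨k, hk⟩).mulVec (embedding w x k hk.le) i ≠ 0

lemma hasDerivAt_relu {z : ℝ} (hz : z ≠ 0) : HasDerivAt relu (heaviside z) z := by
  rcases lt_or_gt_of_ne hz with h | h
  · have : heaviside z = 0 := if_neg h.not_gt
    rw [this]
    refine (hasDerivAt_const z (0 : ℝ)).congr_of_eventuallyEq ?_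
    filter_upwards [gt_mem_nhds h] with y hy
    simp [relu, le_of_lt hy]
  · have : heaviside z = 1 := if_pos h
    rw [this]
    refine (hasDerivAt_id z).congr_of_eventuallyEq ?_
    filter_upwards [lt_mem_nhds h] with y hy
    simp [relu, le_of_lt hy]

lemma hasFDerivAt_coord (w : Params d m L) (i : ParamIndex d m L) :
    HasFDerivAt (fun v : Params d m L => v i)
      (innerSL ℝ (EuclideanSpace.single i (1 : ℝ))) w := by
  have h := (EuclideanSpace.proj i : Params d m L →L[ℝ] ℝ).hasFDerivAt (x := w)
  convert! h using 1
  ext v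
  simp [EuclideanSpace.inner_single_left]

lemma hasFDerivAt_coord_mul {w : Params d m L} (i : ParamIndex d m L) {f : Params d m L → ℝ}
    {g : Params d m L} (hf : HasFDerivAt f (innerSL ℝ g) w) :
    HasFDerivAt (fun v : Params d m L => v i * f v)
      (innerSL ℝ (w i • g + f w • EuclideanSpace.single i (1 : ℝ))) w := by
  have h := (hasFDerivAt_coord w i).fun_mul hf
  convert! h using 1
  rw [map_add, map_smul, map_smul]

/-- Chain and product rules along the recursion. Only differentiability at the given point is
claimed, so it suffices that preactivations are nonzero there. -/
lemma hasFDerivAt_embedding {w : Params d m L} {x : EuclideanSpace ℝ (Fin d)} :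
    ∀ (l : ℕ) (h : l ≤ L), NonzeroPreact w x l → ∀ i,
      HasFDerivAt (fun v : Params d m L => embedding v x l h i) (innerSL ℝ (embGrad w x l h i)) w
  | 0, _, _, i => by
    simp only [embedding, embGrad, map_zero]
    exact hasFDerivAt_const _ _
  | l + 1, h, hnz, i => by
    have ih := hasFDerivAt_embedding l (Nat.le_of_succ_le h)
      (fun k hk hkl => hnz k hk (Nat.lt_succ_of_lt hkl))
    have hsum := HasFDerivAt.fun_sum (u := Finset.univ) fun k _ =>
      hasFDerivAt_coord_mul (Sum.inl ⟨⟨l, h⟩, (i, k)⟩ : ParamIndex d m L) (ih k)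
    have hz := hnz l h (Nat.lt_succ_self l) i
    have hr := ((hasDerivAt_relu hz).comp_hasFDerivAt w (f := fun v : Params d m L =>
      (hiddenWeight v ⟨l, h⟩).mulVec (embedding v x l (Nat.le_of_succ_le h)) i) hsum).const_mul
        (Real.sqrt 2 / Real.sqrt m)
    convert! hr using 1
    rw [embGrad, map_smul, map_sum, mul_smul]
    rfl

/-- The gradient of the network with respect to the parameters. -/
def networkGrad (w : Params d m L) (x : EuclideanSpace ℝ (Fin d)) : Params d m L :=
  ∑ k, (outputWeight w k • embGrad w x L le_rfl k
    + embedding w x L le_rfl k • EuclideanSpace.single (Sum.inr k : ParamIndex d m L) (1 : ℝ))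

lemma modelGradient_eq {w : Params d m L} {x : EuclideanSpace ℝ (Fin d)}
    (hnz : NonzeroPreact w x L) : modelGradient w x = networkGrad w x := by
  have hsum := HasFDerivAt.fun_sum (u := Finset.univ) fun k _ =>
    hasFDerivAt_coord_mul (Sum.inr k : ParamIndex d m L) (hasFDerivAt_embedding L le_rfl hnz k)
  rw [← map_sum] at hsum
  exact HasGradientAt.gradient (f' := networkGrad w x) hsum

/-- An embedding does not depend on later weights, so its gradient is orthogonal to their coordinate
directions. This removes the cross terms in `inner_embGrad`. -/
lemma embGrad_apply_inl (w : Params d m L) (x : EuclideanSpace ℝ (Fin d)) :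
    ∀ (l : ℕ) (h : l ≤ L) (i) (k : Fin L) (p), l ≤ k →
      embGrad w x l h i (Sum.inl ⟨k, p⟩) = 0
  | 0, _, _, _, _, _ => rfl
  | l + 1, h, i, k, p, hk => by
    have ih := fun j => embGrad_apply_inl w x l (Nat.le_of_succ_le h) j k p (Nat.le_of_succ_le hk)
    have hne : (⟨l, h⟩ : Fin L) ≠ k := fun e => by
      have := congrArg Fin.val e; simp at this; omega
    have hne' : ∀ j, (Sum.inl ⟨k, p⟩ : ParamIndex d m L) ≠ Sum.inl ⟨⟨l, h⟩, (i, j)⟩ := fun j e => by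
      exact hne (congrArg Sigma.fst (Sum.inl.inj e)).symm
    simp [embGrad, ih, hne']

lemma embGrad_apply_inr (w : Params d m L) (x : EuclideanSpace ℝ (Fin d)) :
    ∀ (l : ℕ) (h : l ≤ L) (i) (k), embGrad w x l h i (Sum.inr k) = 0
  | 0, _, _, _ => rfl
  | l + 1, h, i, k => by
    have ih := fun j => embGrad_apply_inr w x l (Nat.le_of_succ_le h) j k
    simp [embGrad, ih]

/-- The product rule splits each gradient into a part inherited from earlier layers and a part along
the new weights; `h1` and `h2` say these are orthogonal. -/
lemma inner_sum_smul_add_single {N : ℕ} {I : Type*} [Fintype I] [DecidableEq I]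
    (u v a b : Fin N → ℝ) (g g' : Fin N → EuclideanSpace ℝ I) (e e' : Fin N → I)
    (h1 : ∀ k l, g k (e' l) = 0) (h2 : ∀ k l, g' k (e l) = 0) :
    inner ℝ (∑ k, (u k • g k + a k • EuclideanSpace.single (e k) (1 : ℝ)))
      (∑ k, (v k • g' k + b k • EuclideanSpace.single (e' k) (1 : ℝ)))
      = (∑ k, ∑ l, a k * b l * if e k = e' l then 1 else 0)
        + bilin (Matrix.of fun k l => inner ℝ (g k) (g' l)) u v := by
  rw [sum_inner, bilin, ← Finset.sum_add_distrib]
  refine Finset.sum_congr rfl fun k _ => ?_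
  rw [inner_sum, ← Finset.sum_add_distrib]
  refine Finset.sum_congr rfl fun l _ => ?_
  simp only [inner_add_left, inner_add_right, real_inner_smul_left, real_inner_smul_right,
    EuclideanSpace.inner_single_left, EuclideanSpace.inner_single_right, h2, map_one, one_mul,
    mul_zero, Matrix.of_apply, add_zero, PiLp.smul_apply, conj_trivial, h1,
    PiLp.single_apply, eq_comm (a := e' l), smul_eq_mul]
  ring

lemma inner_embGrad (w : Params d m L) (x y : EuclideanSpace ℝ (Fin d)) :
    ∀ (l : ℕ) (h : l ≤ L) (i j),
      inner ℝ (embGrad w x l h i) (embGrad w y l h j) = ntkAux w x y l h i j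
  | 0, _, _, _ => by simp [embGrad, ntkAux]
  | l + 1, h, i, j => by
    have ih : (Matrix.of fun p q => inner ℝ (embGrad w x l (Nat.le_of_succ_le h) p)
        (embGrad w y l (Nat.le_of_succ_le h) q)) = ntkAux w x y l (Nat.le_of_succ_le h) := by
      ext p q; exact inner_embGrad w x y l (Nat.le_of_succ_le h) p q
    rw [embGrad, embGrad, real_inner_smul_left, real_inner_smul_right, inner_sum_smul_add_single
      _ _ _ _ _ _ _ _ (fun k p => embGrad_apply_inl w x l _ k ⟨l, h⟩ _ le_rfl)
      (fun k p => embGrad_apply_inl w y l _ k ⟨l, h⟩ _ le_rfl), ih, ntkAux]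
    have hs : (∑ k, ∑ p, embedding w x l (Nat.le_of_succ_le h) k
        * embedding w y l (Nat.le_of_succ_le h) p
        * if (Sum.inl ⟨⟨l, h⟩, (i, k)⟩ : ParamIndex d m L) = Sum.inl ⟨⟨l, h⟩, (j, p)⟩ then 1 else 0)
        = if i = j then dotProduct (embedding w x l (Nat.le_of_succ_le h))
          (embedding w y l (Nat.le_of_succ_le h)) else 0 := by
      by_cases hij : i = j
      · subst hij
        simp [dotProduct]
      · simp [hij]
    rw [hs, ← mul_assoc, mul_mul_mul_comm, sqrt_two_div_sqrt_mul_self]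
    rfl

/-- The first term comes from the output weights, the second from all hidden weights; the latter is
a quadratic form in the output row, which is independent of its matrix. -/
lemma ntkMatrix_apply {n : ℕ} {w : Params d m L} {x : Fin n → EuclideanSpace ℝ (Fin d)} {i j : Fin n}
    (hi : NonzeroPreact w (x i) L) (hj : NonzeroPreact w (x j) L) :
    ntkMatrix w x i j = dotProduct (embedding w (x i) L le_rfl) (embedding w (x j) L le_rfl)
      + bilin (ntkAux w (x i) (x j) L le_rfl) (outputWeight w) (outputWeight w) := by
  have ih : (Matrix.of fun p q => inner ℝ (embGrad w (x i) L le_rfl p)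
      (embGrad w (x j) L le_rfl q)) = ntkAux w (x i) (x j) L le_rfl := by
    ext p q; exact inner_embGrad w (x i) (x j) L le_rfl p q
  rw [ntkMatrix, Matrix.of_apply, modelGradient_eq hi, modelGradient_eq hj, networkGrad, networkGrad,
    inner_sum_smul_add_single _ _ _ _ _ _ _ _ (fun k p => embGrad_apply_inr w (x i) L _ k _)
      (fun k p => embGrad_apply_inr w (x j) L _ k _), ih]
  simp [dotProduct]

end

/-! ### Conditioning on the weights of the previous layers -/

/-- Replace the coordinates outside of `p` by zero. -/
def maskCoord {I : Type*} (p : I → Prop) [DecidablePred p] (w : I → ℝ) : I → ℝ :=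
  fun i => if p i then w i else 0

lemma map_comp_gaussVec {I κ : Type*} [Fintype I] [Fintype κ] {e : κ → I}
    (he : Function.Injective e) :
    (gaussVec I).map (fun w k => w (e k)) = gaussVec κ := by
  have h : iIndepFun (fun (i : I) (w : I → ℝ) => w i) (gaussVec I) :=
    iIndepFun_pi (μ := fun _ : I => gaussianReal 0 1) (X := fun _ x => x) fun _ => by fun_prop
  have h2 := (iIndepFun_iff_map_fun_eq_pi_map fun k => (measurable_pi_apply (e k)).aemeasurable).1
    (h.precomp he)
  rw [h2]
  unfold gaussVec
  congr 1
  ext1 k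
  exact (measurePreserving_eval (fun _ : I => gaussianReal 0 1) (e k)).map_eq

/-- Coordinates of a Gaussian vector are independent of the remaining ones: a bound on the
probability of an event for every fixed value of the latter is a bound on its probability. -/
lemma gaussVec_mask_le {I κ : Type*} [Fintype I] [Fintype κ] (p : I → Prop) [DecidablePred p]
    {e : κ → I} (he : Function.Injective e) (hp : ∀ k, ¬ p (e k)) {B : Set ((I → ℝ) × (κ → ℝ))}
    (hB : MeasurableSet B) {c : ℝ≥0∞} (h : ∀ u, gaussVec κ {v | (u, v) ∈ B} ≤ c) :
    gaussVec I {w | (maskCoord p w, fun k => w (e k)) ∈ B} ≤ c := by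
  classical
  have hi : iIndepFun (fun (i : I) (w : I → ℝ) => w i) (gaussVec I) :=
    iIndepFun_pi (μ := fun _ : I => gaussianReal 0 1) (X := fun _ x => x) fun _ => by fun_prop
  have h2 := hi.indepFun_finset (Finset.univ.filter p) (Finset.univ.filter fun i => ¬ p i)
    (Finset.disjoint_filter_filter_not _ _ _) fun i => measurable_pi_apply i
  have hφ : Measurable fun (f : ↥(Finset.univ.filter p) → ℝ) (i : I) =>
      if hpi : p i then f ⟨i, by simp [hpi]⟩ else 0 := by
    refine measurable_pi_lambda _ fun i => ?_
    split_ifs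
    · exact measurable_pi_apply _
    · exact measurable_const
  have hψ : Measurable fun (f : ↥(Finset.univ.filter fun i => ¬ p i) → ℝ) (k : κ) =>
      f ⟨e k, by simp [hp k]⟩ := measurable_pi_lambda _ fun k => measurable_pi_apply _
  -- Both maps factor through restrictions to complementary sets of coordinates. Masking by zero,
  -- rather than restricting, keeps the value a full parameter vector at which embeddings can be
  -- evaluated.
  have h3 : IndepFun (maskCoord p) (fun (w : I → ℝ) k => w (e k)) (gaussVec I) := by
    have h4 := h2.comp hφ hψ
    convert! h4 using 1
  have m1 : Measurable (maskCoord p) := by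
    refine measurable_pi_lambda _ fun i => ?_
    unfold maskCoord
    split_ifs
    · exact measurable_pi_apply _
    · exact measurable_const
  have m2 : Measurable fun (w : I → ℝ) k => w (e k) :=
    measurable_pi_lambda _ fun k => measurable_pi_apply _
  have h5 := (indepFun_iff_map_prod_eq_prod_map_map m1.aemeasurable m2.aemeasurable).1 h3
  have h6 := Measure.map_apply (μ := gaussVec I) (m1.prodMk m2) hB
  have hprob : IsProbabilityMeasure ((gaussVec I).map (maskCoord p)) :=
    Measure.isProbabilityMeasure_map m1.aemeasurable
  rw [h5, map_comp_gaussVec he, Measure.prod_apply hB] at h6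
  refine h6.symm.trans_le ?_
  calc _ ≤ ∫⁻ _, c ∂((gaussVec I).map (maskCoord p)) := lintegral_mono fun u => h u
    _ = c := by simp

/-- Currying is a measurable equivalence, so the identity holds for every set `S`, measurable or
not. -/
lemma gaussVec_prod_apply_curry {m n : ℕ} (S : Set (Fin m → Fin n → ℝ)) :
    gaussVec (Fin m × Fin n) {v | (fun i k => v (i, k)) ∈ S} = gaussMat m n S := by
  have h := Measure.infinitePi_map_curry (fun (_ : Fin m) (_ : Fin n) => gaussianReal 0 1)
  simp_rw [Measure.infinitePi_eq_pi] at h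
  unfold gaussMat gaussVec
  rw [← h, MeasurableEquiv.map_apply]
  rfl

/-! ### Measurability -/

section

variable {Ω : Type*} [MeasurableSpace Ω] {m n : ℕ}

lemma measurable_dotProduct {a b : Ω → Fin n → ℝ} (ha : Measurable a) (hb : Measurable b) :
    Measurable fun ω => dotProduct (a ω) (b ω) := by
  unfold dotProduct; fun_prop

lemma measurable_stepVec {W : Ω → Fin m → Fin n → ℝ} {a : Ω → Fin n → ℝ} (hW : Measurable W)
    (ha : Measurable a) : Measurable fun ω => stepVec (W ω) (a ω) := by
  refine measurable_pi_lambda _ fun i => ?_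
  exact (measurable_relu.comp (measurable_dotProduct ((measurable_pi_apply i).comp hW) ha)).const_mul _

lemma measurable_stepMat {W : Ω → Fin m → Fin n → ℝ} {a b : Ω → Fin n → ℝ}
    {A : Ω → Matrix (Fin n) (Fin n) ℝ} (hW : Measurable W) (ha : Measurable a) (hb : Measurable b)
    (hA : ∀ i j, Measurable fun ω => A ω i j) (i j : Fin m) :
    Measurable fun ω => stepMat (W ω) (a ω) (b ω) (A ω) i j := by
  have h1 := measurable_heaviside.comp
    (measurable_dotProduct ((measurable_pi_apply i).comp hW) ha)
  have h2 := measurable_heaviside.comp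
    (measurable_dotProduct ((measurable_pi_apply j).comp hW) hb)
  have h3 := measurable_dotProduct ha hb
  have h4 : Measurable fun ω => bilin (A ω) (W ω i) (W ω j) := by
    unfold bilin; fun_prop
  simp only [stepMat, Matrix.of_apply]
  refine ((h1.mul h2).const_mul _).mul (Measurable.add ?_ h4)
  split_ifs
  · exact h3
  · exact measurable_const

lemma measurableSet_layerNear {a b : Ω → Fin n → ℝ} {A : Ω → Matrix (Fin n) (Fin n) ℝ}
    (ha : Measurable a) (hb : Measurable b) (hA : ∀ i j, Measurable fun ω => A ω i j)
    (η P Q R T : ℝ) : MeasurableSet {ω | LayerNear η P Q R T (a ω) (b ω) (A ω)} := by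
  have h1 := measurable_dotProduct ha ha
  have h2 := measurable_dotProduct hb hb
  have h3 := measurable_dotProduct ha hb
  have h4 : Measurable fun ω => (A ω).trace := by
    unfold Matrix.trace Matrix.diag; fun_prop
  have h5 : Measurable fun ω => frobSq (A ω) := by
    unfold frobSq; fun_prop
  have e : {ω | LayerNear η P Q R T (a ω) (b ω) (A ω)}
      = {ω | |dotProduct (a ω) (a ω) - P| < η} ∩ ({ω | |dotProduct (b ω) (b ω) - Q| < η} ∩
        ({ω | |dotProduct (a ω) (b ω) - R| < η} ∩ ({ω | |(A ω).trace - T| < η} ∩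
          {ω | frobSq (A ω) < η}))) := by
    ext ω
    exact ⟨fun h => ⟨h.left, h.right, h.inner, h.trace, h.frob⟩,
      fun h => ⟨h.1, h.2.1, h.2.2.1, h.2.2.2.1, h.2.2.2.2⟩⟩
  rw [e]
  refine MeasurableSet.inter ?_ (MeasurableSet.inter ?_ (MeasurableSet.inter ?_
    (MeasurableSet.inter ?_ ?_))) <;>
    refine measurableSet_lt ?_ measurable_const
  · exact (h1.sub measurable_const).abs
  · exact (h2.sub measurable_const).abs
  · exact (h3.sub measurable_const).abs
  · exact (h4.sub measurable_const).abs
  · exact h5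

end

section

variable {d m L : ℕ}

lemma measurable_hiddenWeight (l : Fin L) :
    Measurable fun (w : Params d m L) (i : Fin (width d m (l + 1))) (k : Fin (width d m l)) =>
      hiddenWeight w l i k := by
  refine measurable_pi_lambda _ fun i => measurable_pi_lambda _ fun k => ?_
  simp only [hiddenWeight, Matrix.of_apply]
  fun_prop

lemma measurable_embedding (x : EuclideanSpace ℝ (Fin d)) :
    ∀ (l : ℕ) (h : l ≤ L), Measurable fun w : Params d m L => embedding w x l h
  | 0, _ => measurable_const
  | l + 1, h => measurable_stepVec (m := m) (n := width d m l) (measurable_hiddenWeight ⟨l, h⟩)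
      (measurable_embedding x l (Nat.le_of_succ_le h))

lemma measurable_ntkAux (x y : EuclideanSpace ℝ (Fin d)) :
    ∀ (l : ℕ) (h : l ≤ L) (i j), Measurable fun w : Params d m L => ntkAux w x y l h i j
  | 0, _, _, _ => measurable_const
  | l + 1, h, i, j => measurable_stepMat (m := m) (n := width d m l)
      (measurable_hiddenWeight ⟨l, h⟩) (measurable_embedding x l (Nat.le_of_succ_le h))
      (measurable_embedding y l (Nat.le_of_succ_le h))
      (measurable_ntkAux x y l (Nat.le_of_succ_le h)) i j

/-! ### Dependence on the weights of the previous layers -/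

/-- The parameter belongs to one of the first `l` weight matrices. -/
def BeforeLayer (l : ℕ) : ParamIndex d m L → Prop
  | Sum.inl s => s.1.val < l
  | Sum.inr _ => False

instance (l : ℕ) : DecidablePred (BeforeLayer (d := d) (m := m) (L := L) l)
  | Sum.inl s => inferInstanceAs (Decidable (s.1.val < l))
  | Sum.inr _ => inferInstanceAs (Decidable False)

/-- The parameters of the network in which the weights after the first `l` matrices vanish. -/
def maskParams (l : ℕ) (w : Params d m L) : Params d m L :=
  WithLp.toLp 2 (maskCoord (BeforeLayer l) w)

lemma hiddenWeight_maskParams (w : Params d m L) {l l₀ : ℕ} (h : l < L) (hl : l < l₀) :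
    hiddenWeight (maskParams l₀ w) ⟨l, h⟩ = hiddenWeight w ⟨l, h⟩ := by
  ext i k
  simp [hiddenWeight, maskParams, maskCoord, BeforeLayer, hl]

lemma embedding_maskParams (w : Params d m L) (x : EuclideanSpace ℝ (Fin d)) (l₀ : ℕ) :
    ∀ (l : ℕ) (h : l ≤ L), l ≤ l₀ → embedding (maskParams l₀ w) x l h = embedding w x l h
  | 0, _, _ => rfl
  | l + 1, h, hl => by
    rw [embedding_succ, embedding_succ, hiddenWeight_maskParams w h hl,
      embedding_maskParams w x l₀ l _ (Nat.le_of_succ_le hl)]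

lemma ntkAux_maskParams (w : Params d m L) (x y : EuclideanSpace ℝ (Fin d)) (l₀ : ℕ) :
    ∀ (l : ℕ) (h : l ≤ L), l ≤ l₀ → ntkAux (maskParams l₀ w) x y l h = ntkAux w x y l h
  | 0, _, _ => rfl
  | l + 1, h, hl => by
    rw [ntkAux, ntkAux, hiddenWeight_maskParams w h hl,
      embedding_maskParams w x l₀ l _ (Nat.le_of_succ_le hl),
      embedding_maskParams w y l₀ l _ (Nat.le_of_succ_le hl),
      ntkAux_maskParams w x y l₀ l _ (Nat.le_of_succ_le hl)]

lemma initLaw_apply (S : Set (Params d m L)) :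
    initLaw d m L S = gaussVec (ParamIndex d m L) {u | WithLp.toLp 2 u ∈ S} :=
  (MeasurableEquiv.toLp 2 (ParamIndex d m L → ℝ)).map_apply S

/-- A bound on the probability of an event given the first `l` weight matrices, as a function of
the next one. -/
lemma initLaw_hidden_le {l : ℕ} (h : l < L)
    {B : Set (Params d m L × (Fin m → Fin (width d m l) → ℝ))} (hB : MeasurableSet B) {c : ℝ≥0∞}
    (hc : ∀ u, gaussMat m (width d m l) {W | (u, W) ∈ B} ≤ c) :
    initLaw d m L {w | (maskParams l w, hiddenWeight w ⟨l, h⟩) ∈ B} ≤ c := by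
  have hmeas : Measurable fun q : (ParamIndex d m L → ℝ) × (Fin m × Fin (width d m l) → ℝ) =>
      ((WithLp.toLp 2 q.1, fun i k => q.2 (i, k)) :
        Params d m L × (Fin m → Fin (width d m l) → ℝ)) := by
    refine Measurable.prodMk (by fun_prop) ?_
    exact measurable_pi_lambda _ fun i => measurable_pi_lambda _ fun k => by fun_prop
  have key := gaussVec_mask_le (I := ParamIndex d m L) (κ := Fin m × Fin (width d m l))
    (BeforeLayer l) (e := fun q => Sum.inl ⟨⟨l, h⟩, (q.1, q.2)⟩)
    (fun q q' hq => by
      have := eq_of_heq (Sigma.mk.inj (Sum.inl.inj hq)).2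
      exact Prod.ext (congrArg Prod.fst this) (congrArg Prod.snd this))
    (fun q => by simp [BeforeLayer]) (hmeas hB) (c := c) (fun u => by
      refine le_trans (le_of_eq ?_) (hc (WithLp.toLp 2 u))
      exact gaussVec_prod_apply_curry {W | (WithLp.toLp 2 u, W) ∈ B})
  rw [initLaw_apply]
  exact key

/-- A bound on the probability of an event given all the hidden weights, as a function of the
output weights. -/
lemma initLaw_output_le {B : Set (Params d m L × (Fin (width d m L) → ℝ))} (hB : MeasurableSet B)
    {c : ℝ≥0∞} (hc : ∀ u, gaussVec (Fin (width d m L)) {v | (u, v) ∈ B} ≤ c) :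
    initLaw d m L {w | (maskParams L w, outputWeight w) ∈ B} ≤ c := by
  have hmeas : Measurable fun q : (ParamIndex d m L → ℝ) × (Fin (width d m L) → ℝ) =>
      ((WithLp.toLp 2 q.1, q.2) : Params d m L × (Fin (width d m L) → ℝ)) := by fun_prop
  have key := gaussVec_mask_le (I := ParamIndex d m L) (κ := Fin (width d m L))
    (BeforeLayer L) (e := Sum.inr) Sum.inr_injective
    (fun q => by simp [BeforeLayer]) (hmeas hB) (c := c) (fun u => hc (WithLp.toLp 2 u))
  rw [initLaw_apply]
  exact key

/-! ### The infinite-width limit -/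

/-- The limit of the inner product of the `l`-embeddings. -/
def limInner (P Q R : ℝ) : ℕ → ℝ
  | 0 => R
  | l + 1 => nextInner P Q (limInner P Q R l)

/-- The limit of the trace of the Gram matrix of the gradients of the `l`-embeddings. -/
def limTrace (P Q R : ℝ) : ℕ → ℝ
  | 0 => 0
  | l + 1 => nextTrace P Q (limInner P Q R l) (limTrace P Q R l)

end

/-- Induction on the layer. At layer `0` the gradient matrix is zero, so the Frobenius condition
holds trivially; each further layer is `layerNear_step` applied conditionally on the earlier
weights. -/
lemma eventually_layerNear {d L : ℕ} (x y : EuclideanSpace ℝ (Fin d)) {P Q R : ℝ} (hP : 0 < P)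
    (hQ : 0 < Q) (hx : dotProduct (fun i => x i) (fun i => x i) = P)
    (hy : dotProduct (fun i => y i) (fun i => y i) = Q)
    (hxy : dotProduct (fun i => x i) (fun i => y i) = R) :
    ∀ (l : ℕ) (h : l ≤ L) (ε : ℝ), 0 < ε → ∀ᶠ m : ℕ in atTop,
      initLaw d m L {w | ¬ (LayerNear ε P Q (limInner P Q R l) (limTrace P Q R l)
        (embedding w x l h) (embedding w y l h) (ntkAux w x y l h) ∧
        NonzeroPreact w x l ∧ NonzeroPreact w y l)} ≤ ENNReal.ofReal ε
  | 0, h, ε, hε => by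
    refine Eventually.of_forall fun m => ?_
    have : {w : Params d m L | ¬ (LayerNear ε P Q (limInner P Q R 0) (limTrace P Q R 0)
        (embedding w x 0 h) (embedding w y 0 h) (ntkAux w x y 0 h) ∧
        NonzeroPreact w x 0 ∧ NonzeroPreact w y 0)} = ∅ := by
      refine Set.eq_empty_iff_forall_notMem.2 fun w hw => hw ⟨⟨?_, ?_, ?_, ?_, ?_⟩, ?_, ?_⟩
      · change |dotProduct (fun i : Fin d => x i) (fun i : Fin d => x i) - P| < ε
        rw [hx]; simpa using hε
      · change |dotProduct (fun i : Fin d => y i) (fun i : Fin d => y i) - Q| < ε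
        rw [hy]; simpa using hε
      · change |dotProduct (fun i : Fin d => x i) (fun i : Fin d => y i) - R| < ε
        rw [hxy]; simpa using hε
      · simpa [ntkAux, limTrace] using hε
      · simpa [ntkAux, frobSq] using hε
      · exact fun k _ hk => absurd hk (Nat.not_lt_zero k)
      · exact fun k _ hk => absurd hk (Nat.not_lt_zero k)
    rw [this]; simp
  | l + 1, h, ε, hε => by
    obtain ⟨δ, hδ, hstep⟩ := layerNear_step (limInner P Q R l) (limTrace P Q R l) hP hQ
      (half_pos hε)
    have ih := eventually_layerNear x y hP hQ hx hy hxy l (Nat.le_of_succ_le h) (min δ (ε / 2))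
      (lt_min hδ (half_pos hε))
    filter_upwards [hstep, ih] with m hstep ih
    -- The current layer is good but the next one fails. Including goodness in the event makes its
    -- conditional probability small for every value of the earlier weights, since bad values give
    -- an empty fibre.
    set B : Set (Params d m L × (Fin m → Fin (width d m l) → ℝ)) :=
      {q | LayerNear δ P Q (limInner P Q R l) (limTrace P Q R l)
          (embedding q.1 x l (Nat.le_of_succ_le h)) (embedding q.1 y l (Nat.le_of_succ_le h))
          (ntkAux q.1 x y l (Nat.le_of_succ_le h))} ∩
        ({q | LayerNear (ε / 2) P Q (limInner P Q R (l + 1)) (limTrace P Q R (l + 1))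
          (stepVec q.2 (embedding q.1 x l (Nat.le_of_succ_le h)))
          (stepVec q.2 (embedding q.1 y l (Nat.le_of_succ_le h)))
          (stepMat q.2 (embedding q.1 x l (Nat.le_of_succ_le h))
            (embedding q.1 y l (Nat.le_of_succ_le h)) (ntkAux q.1 x y l (Nat.le_of_succ_le h)))} ∩
        ⋂ i, {q | dotProduct (q.2 i) (embedding q.1 x l (Nat.le_of_succ_le h)) ≠ 0 ∧
          dotProduct (q.2 i) (embedding q.1 y l (Nat.le_of_succ_le h)) ≠ 0})ᶜ with hBdef
    have ma : Measurable fun q : Params d m L × (Fin m → Fin (width d m l) → ℝ) =>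
        embedding q.1 x l (Nat.le_of_succ_le h) := (measurable_embedding x l _).comp measurable_fst
    have mb : Measurable fun q : Params d m L × (Fin m → Fin (width d m l) → ℝ) =>
        embedding q.1 y l (Nat.le_of_succ_le h) := (measurable_embedding y l _).comp measurable_fst
    have mA : ∀ i j, Measurable fun q : Params d m L × (Fin m → Fin (width d m l) → ℝ) =>
        ntkAux q.1 x y l (Nat.le_of_succ_le h) i j :=
      fun i j => (measurable_ntkAux x y l _ i j).comp measurable_fst
    have mne : ∀ {f : Params d m L × (Fin m → Fin (width d m l) → ℝ) → ℝ}, Measurable f →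
        MeasurableSet {q | f q ≠ 0} := fun hf => (hf (measurableSet_singleton 0)).compl
    have hB : MeasurableSet B := by
      refine (measurableSet_layerNear ma mb mA _ _ _ _ _).inter (MeasurableSet.compl
        (MeasurableSet.inter ?_ (MeasurableSet.iInter fun i => MeasurableSet.inter ?_ ?_)))
      · exact measurableSet_layerNear (measurable_stepVec measurable_snd ma)
          (measurable_stepVec measurable_snd mb) (measurable_stepMat measurable_snd ma mb mA) _ _ _ _ _
      · exact mne (measurable_dotProduct ((measurable_pi_apply i).comp measurable_snd) ma)
      · exact mne (measurable_dotProduct ((measurable_pi_apply i).comp measurable_snd) mb)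
    have hBle := initLaw_hidden_le (h : l < L) hB (c := ENNReal.ofReal (ε / 2)) fun u => by
      by_cases hu : LayerNear δ P Q (limInner P Q R l) (limTrace P Q R l)
          (embedding u x l (Nat.le_of_succ_le h)) (embedding u y l (Nat.le_of_succ_le h))
          (ntkAux u x y l (Nat.le_of_succ_le h))
      · refine (measure_mono fun W hW => ?_).trans (hstep _ _ _ _ hu)
        intro hgood
        refine hW.2 ⟨hgood.1, Set.mem_iInter.2 fun i => hgood.2 i⟩
      · have : {W : Fin m → Fin (width d m l) → ℝ | (u, W) ∈ B} = ∅ :=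
          Set.eq_empty_iff_forall_notMem.2 fun W hW => hu hW.1
        rw [this]; simp
    calc _ ≤ initLaw d m L ({w | ¬ (LayerNear (min δ (ε / 2)) P Q (limInner P Q R l)
            (limTrace P Q R l) (embedding w x l (Nat.le_of_succ_le h))
            (embedding w y l (Nat.le_of_succ_le h)) (ntkAux w x y l (Nat.le_of_succ_le h)) ∧
            NonzeroPreact w x l ∧ NonzeroPreact w y l)} ∪
            {w | (maskParams l w, hiddenWeight w ⟨l, h⟩) ∈ B}) := by
          refine measure_mono fun w hw => ?_
          by_contra hc
          rw [Set.mem_union, not_or] at hc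
          obtain ⟨hc1, hc2⟩ := hc
          replace hc1 := not_not.1 hc1
          have hc3 := not_and_not_right.1 hc2 (by
            change LayerNear _ _ _ _ _ _ _ _
            simp only [embedding_maskParams _ _ _ _ _ le_rfl, ntkAux_maskParams _ _ _ _ _ _ le_rfl]
            exact hc1.1.mono (min_le_left _ _))
          obtain ⟨hc4, hc5⟩ := hc3
          replace hc4 : LayerNear _ _ _ _ _ _ _ _ := hc4
          simp only [embedding_maskParams _ _ _ _ _ le_rfl, ntkAux_maskParams _ _ _ _ _ _ le_rfl]
            at hc4
          have hc6 : ∀ i, dotProduct (hiddenWeight w ⟨l, h⟩ i) (embedding w x l (Nat.le_of_succ_le h)) ≠ 0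
              ∧ dotProduct (hiddenWeight w ⟨l, h⟩ i) (embedding w y l (Nat.le_of_succ_le h)) ≠ 0 := by
            intro i
            obtain ⟨t1, t2⟩ := Set.mem_iInter.1 hc5 i
            replace t1 : dotProduct (hiddenWeight w ⟨l, h⟩ i)
              (embedding (maskParams l w) x l (Nat.le_of_succ_le h)) ≠ 0 := t1
            replace t2 : dotProduct (hiddenWeight w ⟨l, h⟩ i)
              (embedding (maskParams l w) y l (Nat.le_of_succ_le h)) ≠ 0 := t2
            rw [embedding_maskParams _ _ _ _ _ le_rfl] at t1 t2
            exact ⟨t1, t2⟩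
          refine hw ⟨hc4.mono (by linarith), fun k hk hkl i => ?_, fun k hk hkl i => ?_⟩
          · rcases Nat.lt_succ_iff_lt_or_eq.1 hkl with h1 | h1
            · exact hc1.2.1 k hk h1 i
            · subst h1; exact (hc6 i).1
          · rcases Nat.lt_succ_iff_lt_or_eq.1 hkl with h1 | h1
            · exact hc1.2.2 k hk h1 i
            · subst h1; exact (hc6 i).2
      _ ≤ ENNReal.ofReal (ε / 2) + ENNReal.ofReal (ε / 2) := by
          refine (measure_union_le _ _).trans (add_le_add (ih.trans ?_) hBle)
          exact ENNReal.ofReal_le_ofReal (min_le_right _ _)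
      _ = ENNReal.ofReal ε := by
          rw [← ENNReal.ofReal_add (by positivity) (by positivity), add_halves]

/-- Given the hidden weights, the quadratic form in the output row concentrates at the trace because
the Frobenius norm is small; inner product and trace have already converged. -/
lemma isInfiniteWidthNTK_limit {d n : ℕ} (L : ℕ) (x : Fin n → EuclideanSpace ℝ (Fin d))
    (hx : ∀ i, x i ≠ 0) :
    IsInfiniteWidthNTK L x (Matrix.of fun i j =>
      limInner (‖x i‖ ^ 2) (‖x j‖ ^ 2) (inner ℝ (x i) (x j)) L
        + limTrace (‖x i‖ ^ 2) (‖x j‖ ^ 2) (inner ℝ (x i) (x j)) L) := by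
  intro i j ε hε
  have hin : ∀ a b : EuclideanSpace ℝ (Fin d),
      dotProduct (fun k => a k) (fun k => b k) = inner ℝ a b := fun a b => by
    simp [dotProduct, PiLp.inner_apply, mul_comm]
  set P := ‖x i‖ ^ 2
  set Q := ‖x j‖ ^ 2
  set R : ℝ := inner ℝ (x i) (x j)
  have hP : 0 < P := pow_pos (norm_pos_iff.2 (hx i)) 2
  have hQ : 0 < Q := pow_pos (norm_pos_iff.2 (hx j)) 2
  refine ENNReal.tendsto_nhds_zero.2 fun η hη => ?_
  obtain ⟨τ, hτ, hτη⟩ : ∃ τ : ℝ, 0 < τ ∧ ENNReal.ofReal τ ≤ η := by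
    rcases eq_or_ne η ∞ with h | h
    · exact ⟨1, one_pos, h ▸ le_top⟩
    · exact ⟨η.toReal, ENNReal.toReal_pos hη.ne' h, (ENNReal.ofReal_toReal h).le⟩
  -- Error budget: `ε / 4` each for the inner product and the trace, `ε / 2` for the quadratic form;
  -- probability budget: `τ / 2` for the hidden layers and `τ / 2` for Chebyshev at the output.
  obtain ⟨δ, hδ, hδ1, hδ2, hδ3⟩ : ∃ δ : ℝ, 0 < δ ∧ δ ≤ ε / 4 ∧ δ ≤ τ / 2 ∧
      2 * δ / (ε / 2) ^ 2 ≤ τ / 2 := by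
    refine ⟨min (ε / 4) (min (τ / 2) (τ / 4 * (ε / 2) ^ 2)), by positivity, min_le_left _ _,
      (min_le_right _ _).trans (min_le_left _ _), ?_⟩
    rw [div_le_iff₀ (by positivity)]
    have : min (ε / 4) (min (τ / 2) (τ / 4 * (ε / 2) ^ 2)) ≤ τ / 4 * (ε / 2) ^ 2 :=
      (min_le_right _ _).trans (min_le_right _ _)
    linarith
  filter_upwards [eventually_layerNear (x i) (x j) (R := R) hP hQ
    ((hin _ _).trans (real_inner_self_eq_norm_sq _))
    ((hin _ _).trans (real_inner_self_eq_norm_sq _)) (hin _ _) L le_rfl δ hδ] with m hm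
  simp only [Matrix.of_apply]
  set B : Set (Params d m L × (Fin (width d m L) → ℝ)) :=
    {q | frobSq (ntkAux q.1 (x i) (x j) L le_rfl) < δ ∧
      ε / 2 ≤ |bilin (ntkAux q.1 (x i) (x j) L le_rfl) q.2 q.2
        - (ntkAux q.1 (x i) (x j) L le_rfl).trace|} with hBdef
  have mA : ∀ k l, Measurable fun q : Params d m L × (Fin (width d m L) → ℝ) =>
      ntkAux q.1 (x i) (x j) L le_rfl k l :=
    fun k l => (measurable_ntkAux (x i) (x j) L le_rfl k l).comp measurable_fst
  have hB : MeasurableSet B := by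
    have m1 : Measurable fun q : Params d m L × (Fin (width d m L) → ℝ) =>
        frobSq (ntkAux q.1 (x i) (x j) L le_rfl) := by unfold frobSq; fun_prop
    have m2 : Measurable fun q : Params d m L × (Fin (width d m L) → ℝ) =>
        |bilin (ntkAux q.1 (x i) (x j) L le_rfl) q.2 q.2
          - (ntkAux q.1 (x i) (x j) L le_rfl).trace| := by
      unfold bilin Matrix.trace Matrix.diag; fun_prop
    exact (measurableSet_lt m1 measurable_const).inter (measurableSet_le measurable_const m2)
  have hBle := initLaw_output_le hB (c := ENNReal.ofReal (τ / 2)) fun u => by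
    by_cases hu : frobSq (ntkAux u (x i) (x j) L le_rfl) < δ
    · refine (measure_mono fun v hv => hv.2).trans
        ((gaussVec_bilin_concentration (ntkAux u (x i) (x j) L le_rfl) (half_pos hε)).trans
          (ENNReal.ofReal_le_ofReal (le_trans ?_ hδ3)))
      gcongr
    · have : {v : Fin (width d m L) → ℝ | (u, v) ∈ B} = ∅ :=
        Set.eq_empty_iff_forall_notMem.2 fun v hv => hu hv.1
      rw [this]; simp
  refine le_trans ?_ hτη
  -- Only monotonicity and subadditivity are applied to the target event, so its measurability is
  -- not required.
  calc _ ≤ initLaw d m L ({w | ¬ (LayerNear δ P Q (limInner P Q R L) (limTrace P Q R L)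
          (embedding w (x i) L le_rfl) (embedding w (x j) L le_rfl)
          (ntkAux w (x i) (x j) L le_rfl) ∧
          NonzeroPreact w (x i) L ∧ NonzeroPreact w (x j) L)} ∪
          {w | (maskParams L w, outputWeight w) ∈ B}) := by
        refine measure_mono fun w hw => ?_
        by_contra hc
        rw [Set.mem_union, not_or] at hc
        obtain ⟨hc1, hc2⟩ := hc
        obtain ⟨hn, hz1, hz2⟩ := not_not.1 hc1
        have hc3 : |bilin (ntkAux w (x i) (x j) L le_rfl) (outputWeight w) (outputWeight w)
            - (ntkAux w (x i) (x j) L le_rfl).trace| < ε / 2 := by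
          by_contra h
          refine hc2 ?_
          change frobSq (ntkAux (maskParams L w) (x i) (x j) L le_rfl) < δ ∧
            ε / 2 ≤ |bilin (ntkAux (maskParams L w) (x i) (x j) L le_rfl) (outputWeight w)
              (outputWeight w) - (ntkAux (maskParams L w) (x i) (x j) L le_rfl).trace|
          rw [ntkAux_maskParams _ _ _ _ _ _ le_rfl]
          exact ⟨hn.frob, not_lt.1 h⟩
        rw [Set.mem_ofPred_eq, ntkMatrix_apply hz1 hz2] at hw
        refine absurd hw (not_le.2 ?_)
        have h1 := abs_lt.1 hn.inner
        have h2 := abs_lt.1 hn.trace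
        have h3 := abs_lt.1 hc3
        rw [abs_lt]
        constructor <;> linarith [h1.1, h1.2, h2.1, h2.2, h3.1, h3.2]
    _ ≤ ENNReal.ofReal (τ / 2) + ENNReal.ofReal (τ / 2) :=
        (measure_union_le _ _).trans
          (add_le_add (hm.trans (ENNReal.ofReal_le_ofReal hδ2)) hBle)
    _ = ENNReal.ofReal τ := by
        rw [← ENNReal.ofReal_add (by positivity) (by positivity), add_halves]

/-! ### The normalized recursion -/

/-- The limiting cosine of the angle between the `l`-embeddings. -/
def cosSeq (r : ℝ) : ℕ → ℝ
  | 0 => r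
  | l + 1 => arcCos1 (cosSeq r l)

/-- The limit of the normalized trace of the Gram matrix of the gradients. -/
def traceSeq (r : ℝ) : ℕ → ℝ
  | 0 => 0
  | l + 1 => arcCos0 (cosSeq r l) * (cosSeq r l + traceSeq r l)

/-- The normalized entry of the infinite-width NTK. -/
def ntkSeq (r : ℝ) (l : ℕ) : ℝ := cosSeq r l + traceSeq r l

lemma ntkSeq_succ (r : ℝ) (l : ℕ) :
    ntkSeq r (l + 1) = cosSeq r (l + 1) + arcCos0 (cosSeq r l) * ntkSeq r l := rfl

/-- The limiting recursion is homogeneous in the two norms, so the norms factor out and only the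
cosine evolves. -/
lemma limInner_eq {p q : ℝ} (hp : 0 < p) (hq : 0 < q) (r : ℝ) (l : ℕ) :
    limInner (p ^ 2) (q ^ 2) (p * q * r) l = p * q * cosSeq r l := by
  induction l with
  | zero => rfl
  | succ l ih =>
    rw [limInner, ih, nextInner, Real.sqrt_sq hp.le, Real.sqrt_sq hq.le, cosSeq,
      mul_div_cancel_left₀ _ (mul_pos hp hq).ne']

lemma limTrace_eq {p q : ℝ} (hp : 0 < p) (hq : 0 < q) (r : ℝ) (l : ℕ) :
    limTrace (p ^ 2) (q ^ 2) (p * q * r) l = p * q * traceSeq r l := by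
  induction l with
  | zero => simp [limTrace, traceSeq]
  | succ l ih =>
    rw [limTrace, ih, limInner_eq hp hq, nextTrace, Real.sqrt_sq hp.le, Real.sqrt_sq hq.le, traceSeq,
      mul_div_cancel_left₀ _ (mul_pos hp hq).ne']
    ring

lemma cosSeq_one (l : ℕ) : cosSeq 1 l = 1 := by
  induction l with
  | zero => rfl
  | succ l ih => rw [cosSeq, ih, arcCos1_one]

lemma ntkSeq_one (l : ℕ) : ntkSeq 1 l = l + 1 := by
  induction l with
  | zero => simp [ntkSeq, cosSeq, traceSeq]
  | succ l ih => rw [ntkSeq_succ, ih, cosSeq_one, cosSeq_one, arcCos0_one]; push_cast; ring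

/-- The increment `(sin φ - φ * cos φ) / π` over `cos φ` is nonnegative by `φ ≤ tan φ`, and cubic in
`φ`. Shrinking the angle by `φ ^ 2` raises the cosine by a cubic amount too, with a larger constant;
hence one layer reduces the angle by at most `φ ^ 2`. -/
lemma arcCos1_cos_bounds {φ : ℝ} (h0 : 0 ≤ φ) (h1 : φ ≤ 1 / 4) :
    Real.cos φ ≤ arcCos1 (Real.cos φ) ∧ arcCos1 (Real.cos φ) ≤ Real.cos (φ - φ ^ 2) := by
  have hpi3 := Real.pi_gt_three
  have hpi4 := Real.pi_le_four
  have hpi := Real.pi_pos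
  have e : arcCos1 (Real.cos φ) = Real.cos φ + (Real.sin φ - φ * Real.cos φ) / Real.pi := by
    rw [arcCos1, Real.arccos_cos h0 (by linarith)]
    field_simp; ring
  rw [e]
  have hcos : 0 < Real.cos φ := Real.cos_pos_of_mem_Ioo ⟨by linarith, by linarith⟩
  constructor
  · have := Real.le_tan h0 (by linarith)
    rw [Real.tan_eq_sin_div_cos, le_div_iff₀ hcos] at this
    have : 0 ≤ (Real.sin φ - φ * Real.cos φ) / Real.pi := div_nonneg (by linarith) hpi.le
    linarith
  · have hsin := Real.sin_le h0
    have hc := Real.one_sub_sq_div_two_le_cos (x := φ)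
    have hnum : Real.sin φ - φ * Real.cos φ ≤ φ ^ 3 / 2 := by nlinarith
    have hφ2 : φ ^ 2 ≤ φ / 4 := by nlinarith
    have hsub : Real.cos (φ - φ ^ 2) - Real.cos φ
        = 2 * Real.sin (φ - φ ^ 2 / 2) * Real.sin (φ ^ 2 / 2) := by
      rw [Real.cos_sub_cos, show (φ - φ ^ 2 + φ) / 2 = φ - φ ^ 2 / 2 by ring,
        show (φ - φ ^ 2 - φ) / 2 = -(φ ^ 2 / 2) by ring, Real.sin_neg]
      ring
    -- Jordan's inequality `2 * x / π ≤ sin x` on both factors, followed by `π ≤ 4`.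
    have s1 := Real.mul_le_sin (x := φ - φ ^ 2 / 2) (by linarith) (by nlinarith)
    have s2 := Real.mul_le_sin (x := φ ^ 2 / 2) (by positivity) (by nlinarith)
    have hA : 0 ≤ 2 / Real.pi * (φ ^ 2 / 2) := by positivity
    have hB : 0 ≤ 2 / Real.pi * (φ - φ ^ 2 / 2) := mul_nonneg (by positivity) (by linarith)
    have s3 := mul_le_mul s1 s2 hA (hB.trans s1)
    have s4 : φ ^ 3 / 2 / Real.pi
        ≤ 2 * (2 / Real.pi * (φ - φ ^ 2 / 2) * (2 / Real.pi * (φ ^ 2 / 2))) := by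
      have e2 : 2 * (2 / Real.pi * (φ - φ ^ 2 / 2) * (2 / Real.pi * (φ ^ 2 / 2)))
          = 4 * ((φ - φ ^ 2 / 2) * φ ^ 2) / Real.pi / Real.pi := by field_simp; ring
      rw [e2]
      refine div_le_div_of_nonneg_right ?_ hpi.le
      rw [le_div_iff₀ hpi]
      have h3 : 0 ≤ φ ^ 3 := by positivity
      have h4 : φ ^ 3 * Real.pi ≤ φ ^ 3 * 4 := mul_le_mul_of_nonneg_left hpi4 h3
      have h5 : φ ^ 2 * φ ^ 2 ≤ φ / 4 * φ ^ 2 := mul_le_mul_of_nonneg_right hφ2 (sq_nonneg _)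
      nlinarith
    have s5 : (Real.sin φ - φ * Real.cos φ) / Real.pi ≤ φ ^ 3 / 2 / Real.pi :=
      div_le_div_of_nonneg_right hnum hpi.le
    linarith

lemma arccos_cosSeq_bounds {θ : ℝ} (h0 : 0 < θ) (l : ℕ) (h1 : l * θ ≤ 1 / 4) (h2 : θ ≤ 1 / 4) :
    θ - l * θ ^ 2 ≤ Real.arccos (cosSeq (Real.cos θ) l) ∧
      Real.arccos (cosSeq (Real.cos θ) l) ≤ θ ∧
      Real.cos θ ≤ cosSeq (Real.cos θ) l ∧ cosSeq (Real.cos θ) l ≤ 1 := by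
  have hpi3 := Real.pi_gt_three
  induction l with
  | zero =>
    rw [cosSeq, Real.arccos_cos h0.le (by linarith)]
    exact ⟨by simp, le_rfl, le_rfl, Real.cos_le_one θ⟩
  | succ l ih =>
    push_cast at h1 ⊢
    obtain ⟨i1, i2, i3, i4⟩ := ih (by nlinarith)
    set φ := Real.arccos (cosSeq (Real.cos θ) l) with hφ
    have hφ0 : 0 ≤ φ := Real.arccos_nonneg _
    have hc : cosSeq (Real.cos θ) l = Real.cos φ :=
      (Real.cos_arccos (by linarith [Real.neg_one_le_cos θ]) i4).symm
    obtain ⟨b1, b2⟩ := arcCos1_cos_bounds hφ0 (i2.trans h2)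
    rw [← hc] at b1 b2
    have hle : φ ^ 2 ≤ φ := by nlinarith
    have e : cosSeq (Real.cos θ) (l + 1) = arcCos1 (cosSeq (Real.cos θ) l) := rfl
    rw [e]
    have lo : φ - φ ^ 2 ≤ Real.arccos (arcCos1 (cosSeq (Real.cos θ) l)) := by
      have := Real.arccos_le_arccos b2
      rwa [Real.arccos_cos (by linarith) (by nlinarith)] at this
    have hi : Real.arccos (arcCos1 (cosSeq (Real.cos θ) l)) ≤ φ := Real.arccos_le_arccos b1
    refine ⟨?_, hi.trans i2, i3.trans b1, b2.trans (Real.cos_le_one _)⟩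
    -- From `φ - φ ^ 2` with `φ ≥ θ - l * θ ^ 2` and `φ ^ 2 ≤ θ ^ 2`.
    nlinarith

/-- Each layer adds at least `1 - θ ^ 2 / 2` and multiplies the old value by at least `1 - θ / π`.
As the old value is at most `l + 1`, the multiplicative losses add up to `θ / π` times a triangular
number. -/
lemma ntkSeq_bounds {θ : ℝ} (h0 : 0 < θ) (l : ℕ) (h1 : l * θ ≤ 1 / 4) (h2 : θ ≤ 1 / 4) :
    (l + 1) * (1 - θ ^ 2 / 2) - θ / Real.pi * (l * (l + 1) / 2) ≤ ntkSeq (Real.cos θ) l ∧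
      ntkSeq (Real.cos θ) l ≤ l + 1 ∧ 0 ≤ ntkSeq (Real.cos θ) l := by
  have hpi3 := Real.pi_gt_three
  have hpi := Real.pi_pos
  have hcl := Real.one_sub_sq_div_two_le_cos (x := θ)
  induction l with
  | zero =>
    have := Real.cos_le_one θ
    simp only [ntkSeq, cosSeq, traceSeq, Nat.cast_zero]
    refine ⟨by simpa using hcl, by simpa using this, ?_⟩
    nlinarith
  | succ l ih =>
    obtain ⟨-, -, c3, c4⟩ := arccos_cosSeq_bounds h0 (l + 1) h1 h2
    push_cast at h1 ⊢
    have hl : (l : ℝ) * θ ≤ 1 / 4 := by nlinarith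
    obtain ⟨i1, i2, i3⟩ := ih hl
    obtain ⟨-, a2, -, -⟩ := arccos_cosSeq_bounds h0 l hl h2
    rw [ntkSeq_succ]
    have hk1 : arcCos0 (cosSeq (Real.cos θ) l) ≤ 1 := by
      have : 0 ≤ Real.arccos (cosSeq (Real.cos θ) l) / Real.pi :=
        div_nonneg (Real.arccos_nonneg _) hpi.le
      unfold arcCos0; linarith
    have hk0 := arcCos0_nonneg (cosSeq (Real.cos θ) l)
    have hk2 : 1 - θ / Real.pi ≤ arcCos0 (cosSeq (Real.cos θ) l) := by
      have := div_le_div_of_nonneg_right a2 hpi.le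
      unfold arcCos0; linarith
    have hcpos : 0 ≤ Real.cos θ := by nlinarith
    have hθpi : 0 ≤ θ / Real.pi := by positivity
    refine ⟨?_, by nlinarith, add_nonneg (hcpos.trans c3) (mul_nonneg hk0 i3)⟩
    have m1 := mul_le_mul_of_nonneg_right hk2 i3
    have m2 := mul_le_mul_of_nonneg_left i2 hθpi
    nlinarith

lemma ntkSeq_div_lt {θ : ℝ} (h0 : 0 < θ) (l : ℕ) (h1 : (l + 1 : ℝ) * θ ≤ 1 / 4) :
    ntkSeq (Real.cos θ) (l + 1) / ((l + 1 : ℕ) + 1) < ntkSeq (Real.cos θ) l / (l + 1) := by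
  have hpi3 := Real.pi_gt_three
  have hpi4 := Real.pi_le_four
  have hpi := Real.pi_pos
  have hl0 : (0 : ℝ) ≤ l := l.cast_nonneg
  have hθ : θ ≤ 1 / 4 := by nlinarith
  have hl : (l : ℝ) * θ ≤ 1 / 4 := by nlinarith
  obtain ⟨b1, -, b3⟩ := ntkSeq_bounds h0 l hl hθ
  obtain ⟨a1, -, -, -⟩ := arccos_cosSeq_bounds h0 l hl hθ
  obtain ⟨-, -, -, c4⟩ := arccos_cosSeq_bounds h0 (l + 1) (by push_cast; exact h1) hθ
  push_cast
  rw [div_lt_div_iff₀ (by positivity) (by positivity), ntkSeq_succ]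
  set K := ntkSeq (Real.cos θ) l
  set φ := Real.arccos (cosSeq (Real.cos θ) l) with hφ
  have e : arcCos0 (cosSeq (Real.cos θ) l) = 1 - φ / Real.pi := rfl
  rw [e]
  -- The small parameter in which gain and loss are compared.
  obtain ⟨t, ht⟩ : ∃ t : ℝ, t = (l + 1) * θ / Real.pi := ⟨_, rfl⟩
  have ht0 : 0 < t := by rw [ht]; positivity
  have ht1 : t ≤ 1 / 12 := by
    rw [ht, div_le_iff₀ hpi]; nlinarith
  have hφt : 3 / 4 * t ≤ (l + 1) * (φ / Real.pi) := by
    -- From `φ ≥ θ - l * θ ^ 2` and `l * θ ≤ 1 / 4`.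
    have : 3 / 4 * θ ≤ φ := by nlinarith
    have h3 := div_le_div_of_nonneg_right this hpi.le
    have h4 := mul_le_mul_of_nonneg_left h3 (show (0 : ℝ) ≤ l + 1 by positivity)
    refine le_trans (le_of_eq ?_) h4
    rw [ht]; ring
  have hK : (l + 1) * (1 - t / 2) ≤ K := by
    refine le_trans ?_ b1
    have h3 : θ ^ 2 / 2 ≤ θ / Real.pi / 2 := by
      have : θ ^ 2 ≤ θ / Real.pi := by rw [le_div_iff₀ hpi]; nlinarith
      linarith
    have h4 : t = l * (θ / Real.pi) + θ / Real.pi := by rw [ht]; ring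
    rw [h4]
    nlinarith
  have hmain : (l + 1 : ℝ) < K * (1 + (l + 1) * (φ / Real.pi)) := by
    have h5 : (l + 1) * (1 - t / 2) * (1 + 3 / 4 * t) ≤ K * (1 + (l + 1) * (φ / Real.pi)) :=
      mul_le_mul hK (by linarith) (by linarith) b3
    refine lt_of_lt_of_le ?_ h5
    -- The product is `1 + t / 4 - 3 * t ^ 2 / 8`, which exceeds `1` for `0 < t < 2 / 3`.
    have h6 : 1 < (1 - t / 2) * (1 + 3 / 4 * t) := by nlinarith
    have h7 : (0 : ℝ) < l + 1 := by positivity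
    nlinarith
  nlinarith

lemma ntkSeq_div_strictAnti {θ : ℝ} (h0 : 0 < θ) {j l : ℕ} (hjl : j < l) (h1 : (l : ℝ) * θ ≤ 1 / 4) :
    ntkSeq (Real.cos θ) l / (l + 1) < ntkSeq (Real.cos θ) j / (j + 1) := by
  induction l with
  | zero => exact absurd hjl (Nat.not_lt_zero j)
  | succ l ih =>
    have hstep := ntkSeq_div_lt h0 l (by push_cast at h1; exact h1)
    rcases Nat.lt_succ_iff_lt_or_eq.1 hjl with h | h
    · refine hstep.trans (ih h ?_)
      push_cast at h1; nlinarith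
    · subst h; exact hstep

/-! ### Condition numbers of two by two matrices -/

/-- The Gram matrix of two vectors of norms `√s p`, `√s q` at an angle of cosine `ρ`. -/
def pairMatrix (s p q ρ : ℝ) : Matrix (Fin 2) (Fin 2) ℝ :=
  !![s * p ^ 2, s * (p * q * ρ); s * (p * q * ρ), s * q ^ 2]

/-- The gap between the eigenvalues of `pairMatrix 1 p q ρ`. -/
def eigenGap (p q ρ : ℝ) : ℝ := Real.sqrt ((p ^ 2 - q ^ 2) ^ 2 + 4 * (p * q * ρ) ^ 2)

lemma posDef_pairMatrix {s p q ρ : ℝ} (hs : 0 < s) (hp : 0 < p) (hq : 0 < q) (h0 : 0 ≤ ρ)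
    (h1 : ρ < 1) : (pairMatrix s p q ρ).PosDef := by
  rw [Matrix.posDef_iff_dotProduct_mulVec]
  refine ⟨?_, fun v hv => ?_⟩
  · ext i j
    fin_cases i <;> fin_cases j <;> simp [pairMatrix]
  -- Completing the square.
  · have e : star v ⬝ᵥ (pairMatrix s p q ρ).mulVec v
        = s * ((p * v 0 + ρ * (q * v 1)) ^ 2 + (1 - ρ ^ 2) * (q * v 1) ^ 2) := by
      simp [pairMatrix, dotProduct, Matrix.mulVec, Fin.sum_univ_two]
      ring
    rw [e]
    have hρ : 0 < 1 - ρ ^ 2 := by nlinarith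
    refine mul_pos hs ?_
    by_cases hv1 : v 1 = 0
    · have hv0 : v 0 ≠ 0 := fun h => hv (by ext i; fin_cases i <;> simp [h, hv1])
      have : 0 < (p * v 0) ^ 2 := by positivity
      simpa [hv1] using this
    · have : 0 < (1 - ρ ^ 2) * (q * v 1) ^ 2 := by positivity
      linarith [sq_nonneg (p * v 0 + ρ * (q * v 1))]

lemma spectrum_pairMatrix (s p q ρ : ℝ) :
    spectrum ℝ (pairMatrix s p q ρ)
      = {s * ((p ^ 2 + q ^ 2 - eigenGap p q ρ) / 2), s * ((p ^ 2 + q ^ 2 + eigenGap p q ρ) / 2)} := by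
  ext μ
  have hD : eigenGap p q ρ ^ 2 = (p ^ 2 - q ^ 2) ^ 2 + 4 * (p * q * ρ) ^ 2 :=
    Real.sq_sqrt (by positivity)
  rw [spectrum.mem_iff, Matrix.isUnit_iff_isUnit_det, isUnit_iff_ne_zero, not_not,
    Set.mem_insert_iff, Set.mem_singleton_iff]
  have e : (algebraMap ℝ (Matrix (Fin 2) (Fin 2) ℝ) μ - pairMatrix s p q ρ).det
      = (μ - s * ((p ^ 2 + q ^ 2 - eigenGap p q ρ) / 2))
        * (μ - s * ((p ^ 2 + q ^ 2 + eigenGap p q ρ) / 2)) := by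
    simp only [Matrix.det_fin_two, pairMatrix, Matrix.sub_apply, Matrix.algebraMap_matrix_apply]
    simp
    linear_combination (s ^ 2 / 4) * hD
  rw [e, mul_eq_zero, sub_eq_zero, sub_eq_zero]

lemma eigenGap_lt {p q ρ : ℝ} (hp : 0 < p) (hq : 0 < q) (h0 : 0 ≤ ρ) (h1 : ρ < 1) :
    eigenGap p q ρ < p ^ 2 + q ^ 2 := by
  rw [eigenGap, Real.sqrt_lt' (by positivity)]
  have : (p * q * ρ) ^ 2 < (p * q) ^ 2 := by
    have hpq := mul_pos hp hq
    rw [mul_pow]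
    have h2 : ρ ^ 2 < 1 := by nlinarith
    have h3 : 0 < (p * q) ^ 2 := by positivity
    nlinarith
  nlinarith

lemma conditionNumber_pairMatrix {s : ℝ} (hs : 0 < s) (p q ρ : ℝ) :
    conditionNumber (pairMatrix s p q ρ)
      = (p ^ 2 + q ^ 2 + eigenGap p q ρ) / (p ^ 2 + q ^ 2 - eigenGap p q ρ) := by
  have hD : 0 ≤ eigenGap p q ρ := Real.sqrt_nonneg _
  have hle : s * ((p ^ 2 + q ^ 2 - eigenGap p q ρ) / 2)
      ≤ s * ((p ^ 2 + q ^ 2 + eigenGap p q ρ) / 2) :=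
    mul_le_mul_of_nonneg_left (by linarith) hs.le
  rw [conditionNumber, spectrum_pairMatrix, csSup_pair, csInf_pair, sup_eq_right.2 hle,
    inf_eq_left.2 hle, mul_div_mul_left _ _ hs.ne', div_div_div_cancel_right₀ two_ne_zero]

/-- With `T = p ^ 2 + q ^ 2`, the ratio `(T + D) / (T - D)` is free of the scale and increases in
the eigenvalue gap `D < T`, which increases in the cosine. -/
lemma conditionNumber_pairMatrix_lt {s s' p q ρ ρ' : ℝ} (hs : 0 < s) (hs' : 0 < s') (hp : 0 < p)
    (hq : 0 < q) (h0 : 0 ≤ ρ) (hρ : ρ < ρ') (h1 : ρ' < 1) :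
    conditionNumber (pairMatrix s p q ρ) < conditionNumber (pairMatrix s' p q ρ') := by
  rw [conditionNumber_pairMatrix hs, conditionNumber_pairMatrix hs']
  have hlt : eigenGap p q ρ < eigenGap p q ρ' := by
    refine Real.sqrt_lt_sqrt (by positivity) ?_
    have hpq := mul_pos hp hq
    have : (p * q * ρ) ^ 2 < (p * q * ρ') ^ 2 :=
      pow_lt_pow_left₀ (mul_lt_mul_of_pos_left hρ hpq) (by positivity) two_ne_zero
    linarith
  have hb := eigenGap_lt hp hq (h0.trans hρ.le) h1
  rw [div_lt_div_iff₀ (by linarith) (by linarith)]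
  have hT : 0 < p ^ 2 + q ^ 2 := by positivity
  nlinarith

/-! ### The Gram matrix and the limiting kernel in the form `pairMatrix`. -/

section

variable {d : ℕ} (x : Fin 2 → EuclideanSpace ℝ (Fin d))

lemma gramMatrix_eq :
    gramMatrix x = pairMatrix 1 ‖x 0‖ ‖x 1‖ (Real.cos (InnerProductGeometry.angle (x 0) (x 1))) := by
  have h : ∀ i j, gramMatrix x i j = inner ℝ (x i) (x j) := fun i j => by
    simp [gramMatrix, featureMatrix, Matrix.mul_apply, PiLp.inner_apply, mul_comm]
  have h01 := InnerProductGeometry.cos_angle_mul_norm_mul_norm (x 0) (x 1)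
  ext i j
  rw [h]
  fin_cases i <;> fin_cases j
  · simp [pairMatrix]
  · simp [pairMatrix, ← h01]; ring
  · simp [pairMatrix, real_inner_comm, ← h01]; ring
  · simp [pairMatrix]

lemma isInfiniteWidthNTK_pairMatrix (h0 : x 0 ≠ 0) (h1 : x 1 ≠ 0) (L : ℕ) :
    IsInfiniteWidthNTK L x (pairMatrix (L + 1) ‖x 0‖ ‖x 1‖
      (ntkSeq (Real.cos (InnerProductGeometry.angle (x 0) (x 1))) L / (L + 1))) := by
  have hx : ∀ i, x i ≠ 0 := fun i => by fin_cases i <;> assumption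
  have h := isInfiniteWidthNTK_limit L x hx
  have hp : 0 < ‖x 0‖ := norm_pos_iff.2 h0
  have hq : 0 < ‖x 1‖ := norm_pos_iff.2 h1
  have hL : (L + 1 : ℝ) ≠ 0 := by positivity
  have key : ∀ i j : Fin 2, ∀ r : ℝ, inner ℝ (x i) (x j) = ‖x i‖ * ‖x j‖ * r →
      limInner (‖x i‖ ^ 2) (‖x j‖ ^ 2) (inner ℝ (x i) (x j)) L
        + limTrace (‖x i‖ ^ 2) (‖x j‖ ^ 2) (inner ℝ (x i) (x j)) L
        = ‖x i‖ * ‖x j‖ * ntkSeq r L := by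
    intro i j r hr
    have hi := norm_pos_iff.2 (hx i)
    have hj := norm_pos_iff.2 (hx j)
    rw [hr, limInner_eq hi hj, limTrace_eq hi hj, ntkSeq]
    ring
  have h01 := InnerProductGeometry.cos_angle_mul_norm_mul_norm (x 0) (x 1)
  convert h using 1
  ext i j
  rw [Matrix.of_apply]
  fin_cases i <;> fin_cases j
  · change _ = limInner (‖x 0‖ ^ 2) (‖x 0‖ ^ 2) (inner ℝ (x 0) (x 0)) L
      + limTrace (‖x 0‖ ^ 2) (‖x 0‖ ^ 2) (inner ℝ (x 0) (x 0)) L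
    rw [key 0 0 1 (by rw [real_inner_self_eq_norm_sq]; ring), ntkSeq_one]
    simp [pairMatrix]; ring
  · change _ = limInner (‖x 0‖ ^ 2) (‖x 1‖ ^ 2) (inner ℝ (x 0) (x 1)) L
      + limTrace (‖x 0‖ ^ 2) (‖x 1‖ ^ 2) (inner ℝ (x 0) (x 1)) L
    rw [key 0 1 _ (by rw [← h01]; ring)]
    simp [pairMatrix]; field_simp
  · change _ = limInner (‖x 1‖ ^ 2) (‖x 0‖ ^ 2) (inner ℝ (x 1) (x 0)) L
      + limTrace (‖x 1‖ ^ 2) (‖x 0‖ ^ 2) (inner ℝ (x 1) (x 0)) L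
    rw [key 1 0 _ (by rw [real_inner_comm, ← h01]; ring)]
    simp [pairMatrix]; field_simp
  · change _ = limInner (‖x 1‖ ^ 2) (‖x 1‖ ^ 2) (inner ℝ (x 1) (x 1)) L
      + limTrace (‖x 1‖ ^ 2) (‖x 1‖ ^ 2) (inner ℝ (x 1) (x 1)) L
    rw [key 1 1 1 (by rw [real_inner_self_eq_norm_sq]; ring), ntkSeq_one]
    simp [pairMatrix]; ring

end

lemma ntkSeq_div_mem {θ : ℝ} (h0 : 0 < θ) (l : ℕ) (h1 : l * θ ≤ 1 / 4) (h2 : θ ≤ 1 / 4) :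
    0 ≤ ntkSeq (Real.cos θ) l / (l + 1) ∧ ntkSeq (Real.cos θ) l / (l + 1) < 1 := by
  have hcos : Real.cos θ < 1 := by
    have := Real.cos_lt_cos_of_nonneg_of_le_pi le_rfl (by linarith [Real.pi_gt_three]) h0
    rwa [Real.cos_zero] at this
  refine ⟨div_nonneg (ntkSeq_bounds h0 l h1 h2).2.2 (by positivity), ?_⟩
  have hz : ntkSeq (Real.cos θ) 0 / ((0 : ℕ) + 1) = Real.cos θ := by
    simp [ntkSeq, cosSeq, traceSeq]
  rcases Nat.eq_zero_or_pos l with rfl | hl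
  · rw [hz]; exact hcos
  · have := ntkSeq_div_strictAnti h0 hl h1
    rw [hz] at this
    exact this.trans hcos

end DeepReLU

end

/-! ### The theorem, with `c = 1 / 4`. -/

theorem mainTheorem2 :
    ∃ c : ℝ, 0 < c ∧
      ∀ (d : ℕ) (x : Fin 2 → EuclideanSpace ℝ (Fin d)),
        x 0 ≠ 0 → x 1 ≠ 0 → 0 < InnerProductGeometry.angle (x 0) (x 1) →
        (∀ L : ℕ, 1 ≤ L → InnerProductGeometry.angle (x 0) (x 1) ≤ c / (L : ℝ) →
          (DeepReLU.gramMatrix x).PosDef ∧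
          ∃ K : Matrix (Fin 2) (Fin 2) ℝ,
            DeepReLU.IsInfiniteWidthNTK L x K ∧ K.PosDef ∧
            DeepReLU.conditionNumber K < DeepReLU.conditionNumber (DeepReLU.gramMatrix x)) ∧
        (∀ L₁ L₂ : ℕ, 1 ≤ L₂ → L₂ < L₁ →
          InnerProductGeometry.angle (x 0) (x 1) ≤ c / (L₁ : ℝ) →
          ∃ K₁ K₂ : Matrix (Fin 2) (Fin 2) ℝ,
            DeepReLU.IsInfiniteWidthNTK L₁ x K₁ ∧ DeepReLU.IsInfiniteWidthNTK L₂ x K₂ ∧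
            K₁.PosDef ∧ K₂.PosDef ∧
            DeepReLU.conditionNumber K₁ < DeepReLU.conditionNumber K₂) := by
  -- The condition on the angle then reads `L * θ ≤ 1 / 4`, the range of validity of the estimates
  -- on `cosSeq` and `ntkSeq`.
  refine ⟨1 / 4, by norm_num, fun d x h0 h1 hθ => ?_⟩
  have hp : 0 < ‖x 0‖ := norm_pos_iff.2 h0
  have hq : 0 < ‖x 1‖ := norm_pos_iff.2 h1
  set θ := InnerProductGeometry.angle (x 0) (x 1) with hθdef
  have hbound : ∀ L : ℕ, 1 ≤ L → θ ≤ 1 / 4 / (L : ℝ) → L * θ ≤ 1 / 4 ∧ θ ≤ 1 / 4 := by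
    intro L hL h
    have hL' : (1 : ℝ) ≤ L := by exact_mod_cast hL
    rw [le_div_iff₀ (by linarith)] at h
    exact ⟨by linarith, by nlinarith⟩
  have hpos : ∀ L : ℕ, (0 : ℝ) < L + 1 := fun L => by positivity
  refine ⟨fun L hL h => ?_, fun L₁ L₂ hL₂ hlt h => ?_⟩
  · obtain ⟨b1, b2⟩ := hbound L hL h
    have hm := DeepReLU.ntkSeq_div_mem hθ L b1 b2
    have hm0 := DeepReLU.ntkSeq_div_mem hθ 0 (by simp) b2
    have hanti := DeepReLU.ntkSeq_div_strictAnti hθ hL b1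
    -- The Gram matrix is the depth-zero kernel, so the first claim compares depths `L` and `0`.
    have hz : DeepReLU.ntkSeq (Real.cos θ) 0 / ((0 : ℕ) + 1) = Real.cos θ := by
      simp [DeepReLU.ntkSeq, DeepReLU.cosSeq, DeepReLU.traceSeq]
    rw [hz] at hm0 hanti
    rw [DeepReLU.gramMatrix_eq]
    exact ⟨DeepReLU.posDef_pairMatrix one_pos hp hq hm0.1 hm0.2, _,
      DeepReLU.isInfiniteWidthNTK_pairMatrix x h0 h1 L,
      DeepReLU.posDef_pairMatrix (hpos L) hp hq hm.1 hm.2,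
      DeepReLU.conditionNumber_pairMatrix_lt (hpos L) one_pos hp hq hm.1 hanti hm0.2⟩
  · obtain ⟨b1, b2⟩ := hbound L₁ (hL₂.trans hlt.le) h
    have hle : (L₂ : ℝ) ≤ L₁ := by exact_mod_cast hlt.le
    have b3 : (L₂ : ℝ) * θ ≤ 1 / 4 := le_trans (mul_le_mul_of_nonneg_right hle hθ.le) b1
    have hm1 := DeepReLU.ntkSeq_div_mem hθ L₁ b1 b2
    have hm2 := DeepReLU.ntkSeq_div_mem hθ L₂ b3 b2
    exact ⟨_, _, DeepReLU.isInfiniteWidthNTK_pairMatrix x h0 h1 L₁,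
      DeepReLU.isInfiniteWidthNTK_pairMatrix x h0 h1 L₂,
      DeepReLU.posDef_pairMatrix (hpos L₁) hp hq hm1.1 hm1.2,
      DeepReLU.posDef_pairMatrix (hpos L₂) hp hq hm2.1 hm2.2,
      DeepReLU.conditionNumber_pairMatrix_lt (hpos L₁) (hpos L₂) hp hq hm1.1
        (DeepReLU.ntkSeq_div_strictAnti hθ hlt b1) hm2.2⟩
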